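/- Consider the following problem: given $n\ge 1$ points $p_1,\dots,p_n$ in the Euclidean plane, find radii $r_1,\dots,r_n\ge 0$ (with no upper bound on the radii) of minimum sum $\sum_i r_i$ such that the disks of radius $r_i$ centred at $p_i$ are connected, i.e. such that the graph on $\{1,\dots,n\}$ in which $i\ne j$ are adjacent if and only if $|p_i-p_j|\le r_i+r_j$ is connected. Call radii satisfying these constraints feasible. This problem has a polynomial-time approximation scheme: there is a single program for the real RAM (unit-cost $+,-,\cdot,/$ and comparisons on real numbers, unit-cost addition, subtraction and comparison of nonnegative integers, indirect addressing, no rounding and no roots) which, given a real $\varepsilon>0$ and the points $p_1,\dots,p_n$, computes feasible radii $r_1,\dots,r_n$ with $$\sum_{i=1}^n r_i\le(1+\varepsilon)\sum_{i=1}^n r_i'\qquad\text{for all feasible } r_1',\dots,r_n',$$ and such that for every fixed $\varepsilon>0$ the number of steps is bounded by a polynomial in $n$ (which may depend on $\varepsilon$). -/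

import Mathlib

/-! ### The connected range assignment problem -/

/-- The connectivity graph of the disks of radii `r i` centred at the points `P i`: two different
indices are adjacent when the distance of the centres is at most the sum of the radii, that is,
when the two disks intersect. -/
def connectivityGraph {n : ℕ} (P : Fin n → EuclideanSpace ℝ (Fin 2)) (r : Fin n → ℝ) :
    SimpleGraph (Fin n) where
  Adj i j := i ≠ j ∧ dist (P i) (P j) ≤ r i + r j
  symm := ⟨fun i j h => ⟨h.1.symm, by rw [dist_comm, add_comm]; exact h.2⟩⟩
  loopless := ⟨fun _ h => h.1 rfl⟩

/-- Feasible solutions: nonnegative radii, not bounded from above, with a connected graph. -/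
def IsFeasible {n : ℕ} (P : Fin n → EuclideanSpace ℝ (Fin 2)) (r : Fin n → ℝ) : Prop :=
  (∀ i, 0 ≤ r i) ∧ (connectivityGraph P r).Connected

/-! ### The real random access machine -/

namespace RealRAM

/-- A state of the machine: index (natural number) registers, real registers, an index memory and
a real memory. A program names only finitely many registers; memory cells are accessed through an
address held in an index register. -/
structure State where
  idx : ℕ → ℕ
  reg : ℕ → ℝ
  imem : ℕ → ℕ
  rmem : ℕ → ℝ

/-- The elementary instructions. Index registers can be set, copied, added and subtracted
(truncated at `0`), but not multiplied; real registers can be set to an integer constant, copied,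
added, subtracted, multiplied and divided. There is no rounding, no root, and no transfer from real
numbers to indices other than by comparisons. -/
inductive Instr
  | iconst (a : ℕ) (c : ℕ)
  | imove (a b : ℕ)
  | iadd (a b c : ℕ)
  | isub (a b c : ℕ)
  | iload (a b : ℕ)
  | istore (a b : ℕ)
  | rconst (a : ℕ) (c : ℤ)
  | rmove (a b : ℕ)
  | radd (a b c : ℕ)
  | rsub (a b c : ℕ)
  | rmul (a b c : ℕ)
  | rdiv (a b c : ℕ)
  | rload (a b : ℕ)
  | rstore (a b : ℕ)

open Function in
/-- The effect of an instruction. The first argument of an instruction is its target; for the two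
store instructions it is the index register that holds the address of the target cell. Division by
zero yields zero (a program can test a divisor beforehand). -/
noncomputable def Instr.apply : Instr → State → State
  | iconst a c, s => { s with idx := update s.idx a c }
  | imove a b, s => { s with idx := update s.idx a (s.idx b) }
  | iadd a b c, s => { s with idx := update s.idx a (s.idx b + s.idx c) }
  | isub a b c, s => { s with idx := update s.idx a (s.idx b - s.idx c) }
  | iload a b, s => { s with idx := update s.idx a (s.imem (s.idx b)) }
  | istore a b, s => { s with imem := update s.imem (s.idx a) (s.idx b) }
  | rconst a c, s => { s with reg := update s.reg a (c : ℝ) }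
  | rmove a b, s => { s with reg := update s.reg a (s.reg b) }
  | radd a b c, s => { s with reg := update s.reg a (s.reg b + s.reg c) }
  | rsub a b c, s => { s with reg := update s.reg a (s.reg b - s.reg c) }
  | rmul a b c, s => { s with reg := update s.reg a (s.reg b * s.reg c) }
  | rdiv a b c, s => { s with reg := update s.reg a (s.reg b / s.reg c) }
  | rload a b, s => { s with reg := update s.reg a (s.rmem (s.idx b)) }
  | rstore a b, s => { s with rmem := update s.rmem (s.idx a) (s.reg b) }

/-- Comparisons of two index registers or of two real registers. -/
inductive Test
  | ile (a b : ℕ)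
  | rle (a b : ℕ)

def Test.Holds : Test → State → Prop
  | ile a b, s => s.idx a ≤ s.idx b
  | rle a b, s => s.reg a ≤ s.reg b

/-- Structured programs. -/
inductive Prog
  | skip
  | instr (i : Instr)
  | seq (p q : Prog)
  | cond (t : Test) (p q : Prog)
  | loop (t : Test) (p : Prog)

/-- `Exec p s s' k`: started in state `s`, the program `p` halts in state `s'` after exactly `k`
steps, where every instruction and every evaluation of a test is one step. -/
inductive Exec : Prog → State → State → ℕ → Prop
  | skip (s : State) : Exec .skip s s 1
  | instr (i : Instr) (s : State) : Exec (.instr i) s (i.apply s) 1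
  | seq {p q : Prog} {s s' s'' : State} {k l : ℕ} :
      Exec p s s' k → Exec q s' s'' l → Exec (.seq p q) s s'' (k + l)
  | cond_true {t : Test} {p q : Prog} {s s' : State} {k : ℕ} :
      t.Holds s → Exec p s s' k → Exec (.cond t p q) s s' (k + 1)
  | cond_false {t : Test} {p q : Prog} {s s' : State} {k : ℕ} :
      ¬ t.Holds s → Exec q s s' k → Exec (.cond t p q) s s' (k + 1)
  | loop_done {t : Test} {p : Prog} {s : State} :
      ¬ t.Holds s → Exec (.loop t p) s s 1
  | loop_step {t : Test} {p : Prog} {s s' s'' : State} {k l : ℕ} :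
      t.Holds s → Exec p s s' k → Exec (.loop t p) s' s'' l →
        Exec (.loop t p) s s'' (k + l + 1)

/-- A program has at most one halting computation from a given state. -/
theorem Exec.deterministic {p : Prog} {s s₁ : State} {k : ℕ} (h : Exec p s s₁ k) :
    ∀ {s₂ : State} {l : ℕ}, Exec p s s₂ l → s₁ = s₂ ∧ k = l := by
  induction h with
  | skip s => intro _ _ h'; cases h'; exact ⟨rfl, rfl⟩
  | instr i s => intro _ _ h'; cases h'; exact ⟨rfl, rfl⟩
  | seq _ _ ih₁ ih₂ =>
    intro _ _ h'
    cases h' with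
    | seq a b =>
      obtain ⟨rfl, rfl⟩ := ih₁ a
      obtain ⟨rfl, rfl⟩ := ih₂ b
      exact ⟨rfl, rfl⟩
  | cond_true ht _ ih =>
    intro _ _ h'
    cases h' with
    | cond_true _ a => obtain ⟨rfl, rfl⟩ := ih a; exact ⟨rfl, rfl⟩
    | cond_false hf _ => exact absurd ht hf
  | cond_false hf _ ih =>
    intro _ _ h'
    cases h' with
    | cond_true ht _ => exact absurd ht hf
    | cond_false _ a => obtain ⟨rfl, rfl⟩ := ih a; exact ⟨rfl, rfl⟩
  | loop_done hf =>
    intro _ _ h'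
    cases h' with
    | loop_done _ => exact ⟨rfl, rfl⟩
    | loop_step ht _ _ => exact absurd ht hf
  | loop_step ht _ _ ih₁ ih₂ =>
    intro _ _ h'
    cases h' with
    | loop_done hf => exact absurd ht hf
    | loop_step _ a b =>
      obtain ⟨rfl, rfl⟩ := ih₁ a
      obtain ⟨rfl, rfl⟩ := ih₂ b
      exact ⟨rfl, rfl⟩

/-- The initial state for the points `P 0, …, P (n - 1)` and the accuracy `ε`: index register `0`
holds `n`, real register `0` holds `ε`, the cells `2 * i` and `2 * i + 1` of the real memory hold
the two coordinates of `P i`, and everything else is zero. -/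
noncomputable def inputState {n : ℕ} (P : Fin n → EuclideanSpace ℝ (Fin 2)) (ε : ℝ) : State where
  idx a := if a = 0 then n else 0
  reg a := if a = 0 then ε else 0
  imem _ := 0
  rmem a := if h : a / 2 < n then P ⟨a / 2, h⟩ ⟨a % 2, Nat.mod_lt a two_pos⟩ else 0

/-- The radii returned in a final state: the `n` cells of the real memory after the input. -/
def output (n : ℕ) (s : State) : Fin n → ℝ :=
  fun i => s.rmem (2 * n + i)

end RealRAM

/-!
Distances of centres in a connected disk graph are bounded by sums of radii along paths. A centroid
argument, by induction on the removal of vertices that do not disconnect the graph, therefore gives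
a single disk that contains all disks and whose radius is the sum of their radii plus the radius of
the disk with the same centre. For a positive integer `q`, choose a set `A` of boundedly many
vertices such that no set of at most `2 * q * |A|` other vertices carries more than the fraction
`1 / q` of the total radius. Outside of `A`, replace each of the heaviest components by one disk
and drop the other components, which are reached by slightly enlarged disks of `A`. This gives
feasible radii of which at most `(2 * q + 1) ^ (q + 1)` are nonzero, and the sum grows at most by
the factor `1 + 2 / q`.

Hence rounding the radii up to multiples of a small fraction `μ` of the extent of the points costs
little, and there are feasible multiples of `μ` whose sum is at most `2 * gridSize q` units. A
multiset of `l` indices describes radii of sum `l * μ`; the numerals in bijective base-`n` notation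
list all multisets in the order of their size, with at most `(n + 1) ^ (2 * gridSize q)` numerals
up to the first feasible one, which is nearly optimal. Connectivity is tested by a graph search
that compares squares, so that no roots are needed.
-/

section WeightedGraph

variable {V : Type*}

/-- A symmetric function `D` on the vertices of `G` that is dominated by the distance in `G` for
the vertex weights `r`, where the length of a path is the total weight of its vertices, both ends
included. -/
structure IsPathBounded (G : SimpleGraph V) (r : V → ℝ) (D : V → V → ℝ) : Prop where
  nonneg : ∀ v, 0 ≤ r v
  symm : ∀ u v, D u v = D v u
  self_le : ∀ v, D v v ≤ r v
  le_add : ∀ w {u v}, G.Adj u v → D w v ≤ D w u + r v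

namespace IsPathBounded

variable {G : SimpleGraph V} {r : V → ℝ} {D : V → V → ℝ}

theorem le_sum_support (h : IsPathBounded G r D) {u v : V} (w : G.Walk u v) :
    D u v ≤ (w.support.map r).sum := by
  induction w with
  | nil => simpa using h.self_le _
  | @cons u u' v huu' w ih =>
    have hstep : D v u ≤ D v u' + r u := h.le_add v huu'.symm
    rw [h.symm v u, h.symm v u'] at hstep
    simp only [SimpleGraph.Walk.support_cons, List.map_cons, List.sum_cons]
    linarith

theorem le_sum [Fintype V] (h : IsPathBounded G r D) (hG : G.Preconnected) (u v : V) :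
    D u v ≤ ∑ x, r x := by
  classical
  obtain ⟨w, hw⟩ := (hG u v).exists_isPath
  calc D u v ≤ (w.support.map r).sum := h.le_sum_support w
    _ = ∑ x ∈ w.support.toFinset, r x := (List.sum_toFinset r hw.support_nodup).symm
    _ ≤ ∑ x, r x := Finset.sum_le_univ_sum_of_nonneg h.nonneg

theorem induce (h : IsPathBounded G r D) (s : Set V) :
    IsPathBounded (G.induce s) (fun v => r v) (fun u v => D u v) where
  nonneg v := h.nonneg v
  symm u v := h.symm u v
  self_le v := h.self_le v
  le_add w _ _ huv := h.le_add w huv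

theorem add_weight [DecidableEq V] (h : IsPathBounded G r D) (p : V) {x : ℝ} (hx : 0 ≤ x) :
    IsPathBounded G (fun v => r v + if v = p then x else 0)
      (fun u v => D u v + if u = p ∨ v = p then x else 0) where
  nonneg v := add_nonneg (h.nonneg v) (by split_ifs <;> simp [hx])
  symm u v := by simp only [h.symm u v, or_comm]
  self_le v := by simpa using h.self_le v
  le_add w u v huv := by
    have := h.le_add w huv
    split_ifs <;> first | linarith | tauto

/-- Here `hc` says that `c` is a centre after the leaf `l` has been contracted onto its neighbour
`p`. It has to be changed only if it is `p` and `l` has more than half of the total weight. -/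
theorem exists_centroid_of_contract [Fintype V] [DecidableEq V] (h : IsPathBounded G r D)
    (hG : G.Preconnected) {l p c : V} (hpl : G.Adj p l)
    (hc : ∀ v ≠ l, D c v + (if c = p ∨ v = p then r l else 0) ≤
      r c + (if c = p then r l else 0) + (∑ x, r x) / 2) :
    ∃ c, ∀ v, D c v ≤ r c + (∑ x, r x) / 2 := by
  by_cases hcp : c = p
  · subst hcp
    simp only [true_or, if_true] at hc
    by_cases hl : r l ≤ (∑ x, r x) / 2
    · refine ⟨c, fun v => ?_⟩
      by_cases hv : v = l
      · subst hv
        linarith [h.le_add c hpl, h.self_le c]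
      · linarith [hc v hv]
    · exact ⟨l, fun v => by linarith [h.le_sum hG l v]⟩
  · simp only [hcp, false_or, if_false, add_zero] at hc
    refine ⟨c, fun v => ?_⟩
    by_cases hv : v = l
    · subst hv
      have hp := hc p hpl.ne
      rw [if_pos rfl] at hp
      linarith [h.le_add c hpl]
    · have hnonneg : 0 ≤ if v = p then r l else 0 := by split_ifs <;> simp [h.nonneg l]
      linarith [hc v hv]

theorem exists_centroid [Fintype V] (h : IsPathBounded G r D) (hG : G.Connected) :
    ∃ c, ∀ v, D c v ≤ r c + (∑ x, r x) / 2 := by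
  classical
  induction hcard : Fintype.card V using Nat.strong_induction_on generalizing V with
  | _ N ih =>
  subst hcard
  rcases subsingleton_or_nontrivial V with hV | hV
  · obtain ⟨c⟩ := hG.nonempty
    refine ⟨c, fun v => ?_⟩
    rw [Subsingleton.elim v c]
    linarith [h.self_le c, Finset.sum_nonneg fun x (_ : x ∈ Finset.univ) => h.nonneg x]
  obtain ⟨l, hl⟩ := hG.exists_connected_induce_compl_singleton_of_finite_nontrivial
  obtain ⟨p, hlp⟩ := hG.preconnected.exists_adj_of_nontrivial l
  let p' : ({l}ᶜ : Set V) := ⟨p, hlp.ne'⟩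
  obtain ⟨c, hc⟩ := ih _ (Fintype.card_subtype_lt (x := l) (by simp))
    ((h.induce {l}ᶜ).add_weight p' (h.nonneg l)) hl rfl
  have hsum : ∑ x : ({l}ᶜ : Set V), (r x + if x = p' then r l else 0) = ∑ x, r x := by
    rw [Finset.sum_add_distrib, Fintype.sum_ite_eq' p', add_comm,
      Fintype.sum_eq_add_sum_subtype_ne r l]
    rfl
  rw [hsum] at hc
  refine h.exists_centroid_of_contract hG.preconnected hlp.symm (c := c) fun v hv => ?_
  simpa only [Subtype.ext_iff] using hc ⟨v, hv⟩

end IsPathBounded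

end WeightedGraph

section DiskGraph

variable {V X : Type*} [PseudoMetricSpace X]

/-- The intersection graph of the balls with centres `P i` and radii `r i` in a metric space: the
`connectivityGraph` for an arbitrary set of indices and an arbitrary space. -/
def diskGraph (P : V → X) (r : V → ℝ) : SimpleGraph V where
  Adj u v := u ≠ v ∧ dist (P u) (P v) ≤ r u + r v
  symm := ⟨fun u v h => ⟨h.1.symm, by rw [dist_comm, add_comm]; exact h.2⟩⟩
  loopless := ⟨fun _ h => h.1 rfl⟩

/-- The total weight of the vertices of a connected component. -/
noncomputable def componentWeight [Fintype V] {G : SimpleGraph V} (r : V → ℝ)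
    (K : G.ConnectedComponent) : ℝ := by
  classical exact ∑ v with G.connectedComponentMk v = K, r v

theorem sum_componentWeight [Fintype V] (G : SimpleGraph V) [Fintype G.ConnectedComponent]
    (r : V → ℝ) : ∑ K : G.ConnectedComponent, componentWeight r K = ∑ v, r v := by
  classical
  exact Finset.sum_fiberwise Finset.univ G.connectedComponentMk r

theorem componentWeight_nonneg [Fintype V] {G : SimpleGraph V} {r : V → ℝ} (hr : ∀ v, 0 ≤ r v)
    (K : G.ConnectedComponent) : 0 ≤ componentWeight r K :=
  Finset.sum_nonneg fun v _ => hr v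

variable {P : V → X} {r r' : V → ℝ}

theorem reachable_diskGraph_of_dist_le {u v : V} (h : dist (P u) (P v) ≤ r u + r v) :
    (diskGraph P r).Reachable u v := by
  by_cases huv : u = v
  · exact huv ▸ .refl _
  · exact SimpleGraph.Adj.reachable ⟨huv, h⟩

theorem diskGraph_mono (hr : r ≤ r') : diskGraph P r ≤ diskGraph P r' :=
  fun u v h => ⟨h.1, h.2.trans (add_le_add (hr u) (hr v))⟩

theorem diskGraph_connected_of_dist_le {u : V} (hr : ∀ v, 0 ≤ r v)
    (hu : ∀ v, dist (P u) (P v) ≤ r u) : (diskGraph P r).Connected :=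
  (SimpleGraph.connected_iff_exists_forall_reachable _).mpr
    ⟨u, fun v => reachable_diskGraph_of_dist_le ((hu v).trans (le_add_of_nonneg_right (hr v)))⟩

theorem isPathBounded_diskGraph (hr : ∀ v, 0 ≤ r v) :
    IsPathBounded (diskGraph P r) r (fun u v => (dist (P u) (P v) + r u + r v) / 2) where
  nonneg := hr
  symm u v := by rw [dist_comm]; ring
  self_le v := by rw [dist_self]; linarith
  le_add w u v huv := by linarith [dist_triangle (P w) (P u) (P v), huv.2]

theorem dist_add_add_le_two_mul_sum [Fintype V] (hr : ∀ v, 0 ≤ r v)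
    (h : (diskGraph P r).Preconnected) (u v : V) :
    dist (P u) (P v) + r u + r v ≤ 2 * ∑ x, r x := by
  linarith [(isPathBounded_diskGraph hr).le_sum h u v]

section Component

variable [Fintype V] (hr : ∀ v, 0 ≤ r v) (K : (diskGraph P r).ConnectedComponent)

theorem componentWeight_eq_sum_supp [Fintype K.supp] :
    componentWeight r K = ∑ v : K.supp, r v := by
  classical
  exact Finset.sum_subtype _ (by simp) r

include hr

theorem dist_add_add_le_two_mul_componentWeight {u v : V} (hu : u ∈ K) (hv : v ∈ K) :
    dist (P u) (P v) + r u + r v ≤ 2 * componentWeight r K := by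
  classical
  rw [componentWeight_eq_sum_supp]
  have := ((isPathBounded_diskGraph hr).induce K.supp).le_sum
    K.connected_toSimpleGraph.preconnected ⟨u, hu⟩ ⟨v, hv⟩
  linarith

theorem exists_component_center :
    ∃ c ∈ K, ∀ v ∈ K, dist (P c) (P v) + r v ≤ componentWeight r K + r c := by
  classical
  obtain ⟨c, hc⟩ := ((isPathBounded_diskGraph hr).induce K.supp).exists_centroid
    K.connected_toSimpleGraph
  refine ⟨c, c.2, fun v hv => ?_⟩
  rw [componentWeight_eq_sum_supp]
  linarith [hc ⟨v, hv⟩]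

end Component

theorem card_filter_lt_mul_le {κ : Type*} [Fintype κ] {f : κ → ℝ} (hf : ∀ k, 0 ≤ f k) {S : ℝ}
    (hS : ∑ k, f k ≤ S) (m : ℕ) : (Finset.univ.filter fun k => S < m * f k).card ≤ m := by
  set T := Finset.univ.filter fun k => S < m * f k
  have hS0 : 0 ≤ S := (Finset.sum_nonneg fun k _ => hf k).trans hS
  rcases T.eq_empty_or_nonempty with hT | hT
  · simp [hT]
  have hlt : T.card * S < m * S := calc
    T.card * S = ∑ _k ∈ T, S := by rw [Finset.sum_const, nsmul_eq_mul]
    _ < ∑ k ∈ T, m * f k := Finset.sum_lt_sum_of_nonempty hT fun k hk => (Finset.mem_filter.mp hk).2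
    _ = m * ∑ k ∈ T, f k := (Finset.mul_sum ..).symm
    _ ≤ m * S := by
      gcongr
      exact (Finset.sum_le_univ_sum_of_nonneg hf).trans hS
  exact_mod_cast (lt_of_mul_lt_mul_right hlt hS0).le

/-- A component of weight more than `S / m` is covered by a disk around its centroid. -/
theorem exists_cover_components [Fintype V] (hr : ∀ v, 0 ≤ r v) {S : ℝ} (hS : ∑ v, r v ≤ S)
    {m : ℕ} (hm : 0 < m) :
    ∃ (T : Finset V) (ρ : V → ℝ), T.card ≤ m ∧ (∀ c, 0 ≤ ρ c) ∧
      ∑ c ∈ T, ρ c ≤ ∑ v, r v + ∑ c ∈ T, r c ∧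
      ∀ K : (diskGraph P r).ConnectedComponent,
        (∀ u ∈ K, ∀ v ∈ K, dist (P u) (P v) + r u ≤ 2 * (S / m)) ∨
          ∃ c ∈ T, ∀ v ∈ K, dist (P c) (P v) + r v ≤ ρ c := by
  classical
  have hw := componentWeight_nonneg (G := diskGraph P r) hr
  have hwsum := sum_componentWeight (diskGraph P r) r
  choose c hmk hc using exists_component_center (P := P) hr
  change ∀ K, (diskGraph P r).connectedComponentMk (c K) = K at hmk
  have hc_inj : Function.Injective c := fun K L h => by rw [← hmk K, ← hmk L, h]
  let H : Finset (diskGraph P r).ConnectedComponent := {K | S < m * componentWeight r K}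
  refine ⟨H.image c, fun v => componentWeight r ((diskGraph P r).connectedComponentMk v) + r v,
    ?_, fun v => add_nonneg (hw _) (hr v), ?_, fun K => ?_⟩
  · exact Finset.card_image_le.trans (card_filter_lt_mul_le hw (hwsum.le.trans hS) m)
  · rw [Finset.sum_add_distrib, Finset.sum_image hc_inj.injOn, ← hwsum]
    gcongr
    simp only [hmk]
    exact Finset.sum_le_univ_sum_of_nonneg hw
  · by_cases hK : S < m * componentWeight r K
    · refine .inr ⟨c K, Finset.mem_image_of_mem c (by simpa [H]), fun v hv => ?_⟩
      simpa only [hmk] using hc K v hv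
    · have hwK : componentWeight r K ≤ S / m := (le_div_iff₀' (by positivity)).mpr (not_lt.mp hK)
      exact .inl fun u hu v hv => by
        linarith [dist_add_add_le_two_mul_componentWeight hr K hu hv, hr v]

end DiskGraph

section Sparsification

theorem connected_of_adj_imp_reachable {V : Type*} {G G' : SimpleGraph V} (hG : G.Connected)
    (h : ∀ {u v}, G.Adj u v → G'.Reachable u v) : G'.Connected where
  preconnected u v := by
    obtain ⟨w⟩ := hG.preconnected u v
    induction w with
    | nil => exact .refl _
    | cons huv _ ih => exact (h huv).trans ih
  nonempty := hG.nonempty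

/-- If every `A` failed, adding the set `T` to `A` would, `q` times in a row, increase its sum by
more than the fraction `1 / q` of the total. -/
theorem exists_finset_forall_disjoint_sum_le {V : Type*} [Fintype V] {r : V → ℝ} (v₀ : V)
    (hr : ∀ v, 0 ≤ r v) {q : ℕ} (hq : 0 < q) :
    ∃ A : Finset V, A.Nonempty ∧ A.card ≤ (2 * q + 1) ^ q ∧
      ∀ T : Finset V, Disjoint T A → T.card ≤ 2 * q * A.card → ∑ v ∈ T, r v ≤ (∑ v, r v) / q := by
  classical
  by_contra! hcon
  have hq' : (0 : ℝ) < q := by exact_mod_cast hq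
  have hgrow : ∀ j ≤ q, ∃ A : Finset V, A.Nonempty ∧ A.card ≤ (2 * q + 1) ^ j ∧
      j * ((∑ v, r v) / q) ≤ ∑ v ∈ A, r v := by
    intro j hj
    induction j with
    | zero => exact ⟨{v₀}, by simp, by simp, by simp [hr]⟩
    | succ j ih =>
      obtain ⟨A, hA, hcard, hsum⟩ := ih (by lia)
      obtain ⟨T, hT, hTcard, hTsum⟩ := hcon A hA (hcard.trans (by gcongr <;> lia))
      refine ⟨T ∪ A, hA.mono Finset.subset_union_right, ?_, ?_⟩
      · rw [Finset.card_union_of_disjoint hT, pow_succ']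
        nlinarith
      · rw [Finset.sum_union hT]
        push_cast
        linarith
  obtain ⟨A, hA, hcard, hsum⟩ := hgrow q le_rfl
  obtain ⟨T, hT, -, hTsum⟩ := hcon A hA hcard
  rw [mul_div_cancel₀ _ hq'.ne'] at hsum
  have hTA : ∑ v ∈ T, r v + ∑ v ∈ A, r v ≤ ∑ v, r v := by
    rw [← Finset.sum_union hT]
    exact Finset.sum_le_univ_sum_of_nonneg hr
  have : 0 ≤ (∑ v, r v) / q := div_nonneg (Finset.sum_nonneg fun v _ => hr v) hq'.le
  linarith

variable {V X : Type*} [PseudoMetricSpace X] {P : V → X} {r r' : V → ℝ} {A : Finset V}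

variable (P r A) in
/-- The disk graph that is left when the vertices in `A` are removed. -/
abbrev outerGraph : SimpleGraph {v // v ∉ A} :=
  diskGraph (fun v => P v) (fun v => r v)

theorem exists_adj_mem_component (hG : (diskGraph P r).Preconnected) (hA : A.Nonempty)
    (K : (outerGraph P r A).ConnectedComponent) :
    ∃ a ∈ A, ∃ x ∈ K, (diskGraph P r).Adj x a := by
  obtain ⟨a₀, ha₀⟩ := hA
  obtain ⟨v, hv⟩ := K.nonempty_supp
  obtain ⟨w⟩ := hG v a₀
  obtain ⟨d, -, ⟨x, hx, hxd⟩, hd⟩ :=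
    w.exists_boundary_dart (Set.image Subtype.val K.supp) ⟨v, hv, rfl⟩
      (by rintro ⟨u, -, rfl⟩; exact u.2 ha₀)
  have hadj : (diskGraph P r).Adj x d.snd := hxd ▸ d.adj
  refine ⟨d.snd, by_contra fun hdA => hd ⟨⟨d.snd, hdA⟩, ?_, rfl⟩, x, hx, hadj⟩
  exact K.mem_supp_of_adj_mem_supp hx ⟨fun h => hadj.1 (congrArg Subtype.val h), hadj.2⟩

/-- The radii of the vertices in `A` are increased by `δ`. A disk of `A` that touches a component
of diameter at most `δ` then reaches all of it; any other component is covered by a single disk. -/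
theorem diskGraph_connected_of_outerGraph (hr : ∀ v, 0 ≤ r v) (hr' : ∀ v, 0 ≤ r' v)
    (hG : (diskGraph P r).Connected) (hA : A.Nonempty) {δ : ℝ} (hδ : 0 ≤ δ)
    (hrA : ∀ a ∈ A, r a + δ ≤ r' a)
    (hK : ∀ K : (outerGraph P r A).ConnectedComponent,
      (∀ u ∈ K, ∀ v ∈ K, dist (P u) (P v) + r u ≤ δ) ∨
        ∃ c, ∀ v ∈ K, dist (P c) (P v) + r v ≤ r' c) :
    (diskGraph P r').Connected := by
  have htouch : ∀ {x y : {v // v ∉ A}} {a : V}, a ∈ A → (diskGraph P r).Adj x a →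
      (outerGraph P r A).Reachable y x → (diskGraph P r').Reachable a y := by
    intro x y a ha hxa hyx
    have hax : dist (P a) (P x) ≤ r a + r x := hxa.symm.2
    have hra := hrA a ha
    have hy : y ∈ (outerGraph P r A).connectedComponentMk x :=
      SimpleGraph.ConnectedComponent.eq.mpr hyx
    rcases hK (.mk _ x) with hlight | ⟨c, hc⟩
    · refine reachable_diskGraph_of_dist_le ?_
      linarith [hlight x rfl y hy, dist_triangle (P a) (P x) (P y), hr' y]
    · refine (reachable_diskGraph_of_dist_le (v := c) ?_).trans (reachable_diskGraph_of_dist_le ?_)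
      · linarith [hc x rfl, dist_triangle_right (P a) (P c) (P x)]
      · linarith [hc y hy, hr y, hr' y]
  refine connected_of_adj_imp_reachable hG fun {u v} huv => ?_
  by_cases hu : u ∈ A <;> by_cases hv : v ∈ A
  · exact reachable_diskGraph_of_dist_le (by linarith [huv.2, hrA u hu, hrA v hv])
  · exact htouch (x := ⟨v, hv⟩) (y := ⟨v, hv⟩) hu huv.symm (.refl _)
  · exact (htouch (x := ⟨u, hu⟩) (y := ⟨u, hu⟩) hv huv (.refl _)).symm
  · have huv' : (outerGraph P r A).Adj ⟨u, hu⟩ ⟨v, hv⟩ :=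
      ⟨fun h => huv.1 (congrArg Subtype.val h), huv.2⟩
    obtain ⟨a, ha, x, hx, hxa⟩ := exists_adj_mem_component hG.preconnected hA (.mk _ ⟨u, hu⟩)
    have hux := (SimpleGraph.ConnectedComponent.eq.mp hx).symm
    exact (htouch ha hxa hux).symm.trans (htouch ha hxa (huv'.symm.reachable.trans hux))

open scoped Classical in
theorem exists_le_comp_sum_eq {κ V : Type*} [Fintype V] (s : Finset κ) (c : κ → V) {ρ : κ → ℝ}
    (hρ : ∀ k, 0 ≤ ρ k) :
    ∃ r : V → ℝ, (∀ v, 0 ≤ r v) ∧ (∀ k ∈ s, ρ k ≤ r (c k)) ∧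
      (Finset.univ.filter fun v => r v ≠ 0).card ≤ s.card ∧ ∑ v, r v = ∑ k ∈ s, ρ k := by
  refine ⟨fun v => ∑ k ∈ s with c k = v, ρ k, fun v => Finset.sum_nonneg fun k _ => hρ k,
    fun k hk => ?_, ?_, Finset.sum_fiberwise s c ρ⟩
  · exact Finset.single_le_sum (f := ρ) (fun k _ => hρ k) (Finset.mem_filter.mpr ⟨hk, rfl⟩)
  · refine (Finset.card_le_card fun v hv => ?_).trans (Finset.card_image_le (s := s) (f := c))
    obtain ⟨k, hk, -⟩ := Finset.exists_ne_zero_of_sum_ne_zero (Finset.mem_filter.mp hv).2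
    exact Finset.mem_image.mpr ⟨k, (Finset.mem_filter.mp hk).1, (Finset.mem_filter.mp hk).2⟩

open scoped Classical in
theorem exists_sparse_of_forall_disjoint_sum_le [Fintype V] (hr : ∀ v, 0 ≤ r v)
    (hG : (diskGraph P r).Connected) (hA : A.Nonempty) {q : ℕ} (hq : 0 < q)
    (hAT : ∀ T : Finset V, Disjoint T A → T.card ≤ 2 * q * A.card →
      ∑ v ∈ T, r v ≤ (∑ v, r v) / q) :
    ∃ r' : V → ℝ, (∀ v, 0 ≤ r' v) ∧ (diskGraph P r').Connected ∧
      (Finset.univ.filter fun v => r' v ≠ 0).card ≤ (2 * q + 1) * A.card ∧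
      ∑ v, r' v ≤ (1 + 2 / q) * ∑ v, r v := by
  set S := ∑ v, r v
  have hS : 0 ≤ S := Finset.sum_nonneg fun v _ => hr v
  have houter : ∑ v ∈ A, r v + ∑ v : {v // v ∉ A}, r v = S := by
    rw [← Finset.sum_subtype Aᶜ (by simp) r, Finset.sum_add_sum_compl]
  obtain ⟨T, ρ, hTcard, hρ, hρsum, hT⟩ := exists_cover_components
    (P := fun v : {v // v ∉ A} => P v) (fun v => hr v)
    (houter ▸ le_add_of_nonneg_left (Finset.sum_nonneg fun v _ => hr v))
    (m := 2 * q * A.card) (Nat.mul_pos (by lia) hA.card_pos)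
  set δ := 2 * (S / (2 * q * A.card : ℕ))
  have hδ : A.card * δ = S / q := by
    have := hA.card_ne_zero
    simp only [δ]
    push_cast
    field_simp
  have hcenters : ∑ v ∈ T, r v ≤ S / q := by
    rw [← Finset.sum_image (f := r) Subtype.val_injective.injOn]
    refine hAT _ ?_ (Finset.card_image_le.trans hTcard)
    simp only [Finset.disjoint_left, Finset.mem_image]
    rintro _ ⟨v, -, rfl⟩
    exact v.2
  obtain ⟨r', hr', hle, hcard, hsum⟩ := exists_le_comp_sum_eq (A.disjSum T)
    (Sum.elim id Subtype.val) (ρ := Sum.elim (fun v => r v + δ) ρ)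
    (Sum.rec (fun v => add_nonneg (hr v) (by positivity)) hρ)
  rw [Finset.card_disjSum] at hcard
  simp only [Finset.sum_disjSum, Sum.elim_inl, Sum.elim_inr, Finset.sum_add_distrib,
    Finset.sum_const, nsmul_eq_mul, hδ] at hsum
  refine ⟨r', hr', diskGraph_connected_of_outerGraph hr hr' hG hA (δ := δ) (by positivity)
    (fun a ha => hle (.inl a) (by simpa)) fun K => ?_, by lia, ?_⟩
  · refine (hT K).imp_right fun ⟨c, hcT, hc⟩ => ⟨c, fun v hv => ?_⟩
    exact (hc v hv).trans (hle (.inr c) (by simpa))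
  · calc ∑ v, r' v ≤ S + S / q + S / q := by linarith
      _ = (1 + 2 / q) * S := by ring

open scoped Classical in
theorem exists_sparse [Fintype V] (hr : ∀ v, 0 ≤ r v) (hG : (diskGraph P r).Connected)
    {q : ℕ} (hq : 0 < q) :
    ∃ r' : V → ℝ, (∀ v, 0 ≤ r' v) ∧ (diskGraph P r').Connected ∧
      (Finset.univ.filter fun v => r' v ≠ 0).card ≤ (2 * q + 1) ^ (q + 1) ∧
      ∑ v, r' v ≤ (1 + 2 / q) * ∑ v, r v := by
  obtain ⟨v₀⟩ := hG.nonempty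
  obtain ⟨A, hA, hcard, hAT⟩ := exists_finset_forall_disjoint_sum_le v₀ hr hq
  obtain ⟨r', hr', hG', hcard', hsum⟩ := exists_sparse_of_forall_disjoint_sum_le hr hG hA hq hAT
  exact ⟨r', hr', hG', by rw [pow_succ']; exact hcard'.trans (by gcongr), hsum⟩

end Sparsification

section Grid

variable {V X : Type*} [PseudoMetricSpace X] {P : V → X} {r : V → ℝ}

theorem exists_nat_mul_connected [Fintype V] (hr : ∀ v, 0 ≤ r v)
    (hG : (diskGraph P r).Connected) {q : ℕ} (hq : 0 < q) {μ : ℝ} (hμ : 0 < μ) :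
    ∃ a : V → ℕ, (diskGraph P fun v => μ * a v).Connected ∧
      ∑ v, μ * a v ≤ (1 + 2 / q) * ∑ v, r v + (2 * q + 1) ^ (q + 1) * μ := by
  classical
  obtain ⟨r', hr', hG', hcard, hsum⟩ := exists_sparse hr hG hq
  refine ⟨fun v => ⌈r' v / μ⌉₊, hG'.mono (diskGraph_mono fun v => ?_), ?_⟩
  · exact (div_le_iff₀' hμ).mp (Nat.le_ceil _)
  have hceil : ∀ v, μ * (⌈r' v / μ⌉₊ : ℝ) ≤ r' v + if r' v ≠ 0 then μ else 0 := by
    intro v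
    split_ifs with hv
    · calc μ * (⌈r' v / μ⌉₊ : ℝ) ≤ μ * (r' v / μ + 1) := by
            gcongr
            exact (Nat.ceil_lt_add_one (div_nonneg (hr' v) hμ.le)).le
        _ = r' v + μ := by field_simp
    · simp [not_not.mp hv]
  calc ∑ v, μ * (⌈r' v / μ⌉₊ : ℝ) ≤ ∑ v, (r' v + if r' v ≠ 0 then μ else 0) :=
        Finset.sum_le_sum fun v _ => hceil v
    _ = ∑ v, r' v + (Finset.univ.filter fun v => r' v ≠ 0).card * μ := by
        rw [Finset.sum_add_distrib, ← Finset.sum_filter, Finset.sum_const, nsmul_eq_mul]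
    _ ≤ _ := by
        gcongr
        exact_mod_cast hcard

/-- `M` is, up to a factor of two, the radius of the points `P v` around the point `P v₀`. -/
structure IsExtent (P : V → X) (v₀ : V) (M : ℝ) : Prop where
  dist_le : ∀ v, dist (P v₀) (P v) ≤ 2 * M
  le_dist : ∃ v, M ≤ dist (P v₀) (P v)

/-- The radii that are tried are multiples of the extent divided by this number; with
`exists_nat_mul_connected`, rounding up costs only a fraction `1 / q` of the extent. -/
def gridSize (q : ℕ) : ℕ := q * (2 * q + 1) ^ (q + 1)

theorem gridSize_pos {q : ℕ} (hq : 0 < q) : 0 < gridSize q := by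
  unfold gridSize
  positivity

namespace IsExtent

variable {v₀ : V} {M : ℝ}

theorem nonneg (h : IsExtent P v₀ M) : 0 ≤ M := by
  have := h.dist_le v₀
  rw [dist_self] at this
  linarith

theorem le_two_mul_sum [Fintype V] (h : IsExtent P v₀ M) (hr : ∀ v, 0 ≤ r v)
    (hG : (diskGraph P r).Preconnected) : M ≤ 2 * ∑ v, r v := by
  obtain ⟨v, hv⟩ := h.le_dist
  linarith [dist_add_add_le_two_mul_sum hr hG v₀ v, hr v₀, hr v]

theorem exists_sum_eq_connected [Fintype V] (h : IsExtent P v₀ M) {q : ℕ} (hq : 0 < q) :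
    ∃ a : V → ℕ, ∑ v, a v = 2 * gridSize q ∧
      (diskGraph P fun v => M / gridSize q * a v).Connected := by
  classical
  have hgrid : (gridSize q : ℝ) ≠ 0 := by exact_mod_cast (gridSize_pos hq).ne'
  refine ⟨Pi.single v₀ (2 * gridSize q), by simp, diskGraph_connected_of_dist_le (u := v₀)
    (fun v => mul_nonneg (div_nonneg h.nonneg (Nat.cast_nonneg _)) (Nat.cast_nonneg _))
    fun v => (h.dist_le v).trans_eq ?_⟩
  rw [Pi.single_eq_same]
  push_cast
  field_simp

theorem exists_sum_le_connected [Fintype V] (h : IsExtent P v₀ M) {q : ℕ} (hq : 0 < q)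
    (hr : ∀ v, 0 ≤ r v) (hG : (diskGraph P r).Connected) :
    ∃ a : V → ℕ, (diskGraph P fun v => M / gridSize q * a v).Connected ∧
      ∑ v, M / gridSize q * a v ≤ (1 + 4 / q) * ∑ v, r v := by
  have hr_sum : 0 ≤ ∑ v, r v := Finset.sum_nonneg fun v _ => hr v
  rcases h.nonneg.eq_or_lt with rfl | hM
  · obtain ⟨a, -, ha⟩ := h.exists_sum_eq_connected hq
    refine ⟨a, ha, ?_⟩
    simp only [zero_div, zero_mul, Finset.sum_const_zero]
    positivity
  have hgrid : (0 : ℝ) < gridSize q := by exact_mod_cast gridSize_pos hq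
  obtain ⟨a, ha, hsum⟩ := exists_nat_mul_connected hr hG hq (div_pos hM hgrid)
  refine ⟨a, ha, hsum.trans ?_⟩
  have hround : (2 * q + 1 : ℝ) ^ (q + 1) * (M / gridSize q) = M / q := by
    simp only [gridSize]
    push_cast
    field_simp
  calc _ = (1 + 2 / q) * ∑ v, r v + M / q := by rw [hround]
    _ ≤ (1 + 2 / q) * ∑ v, r v + 2 * (∑ v, r v) / q := by
        gcongr
        exact h.le_two_mul_sum hr hG.preconnected
    _ = (1 + 4 / q) * ∑ v, r v := by ring

end IsExtent

end Grid

section Numerals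

/-- The digits, least significant first, of `t` in bijective base-`n` notation, with digits
`0, …, n - 1` standing for `1, …, n`. Every list of digits is the list of exactly one number, so
that the numbers below `(n + 1) ^ l` enumerate all lists of length at most `l`. -/
def bijDigits (n : ℕ) : ℕ → List ℕ
  | 0 => []
  | t + 1 => t % n :: bijDigits n (t / n)
decreasing_by exact Nat.lt_succ_of_le (Nat.div_le_self _ _)

theorem bijDigits_succ (n t : ℕ) : bijDigits n (t + 1) = t % n :: bijDigits n (t / n) := by
  rw [bijDigits]

variable {n : ℕ}

theorem length_bijDigits_mono (n : ℕ) : Monotone fun t => (bijDigits n t).length := by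
  intro s t hst
  induction t using Nat.strong_induction_on generalizing s with
  | _ t ih =>
  cases s with
  | zero => simp [bijDigits]
  | succ s =>
    obtain ⟨t, rfl⟩ : ∃ t', t = t' + 1 := ⟨t - 1, by lia⟩
    simp only [bijDigits_succ, List.length_cons, add_le_add_iff_right]
    exact ih _ (Nat.lt_succ_of_le (Nat.div_le_self _ _)) (Nat.div_le_div_right (by lia))

theorem lt_of_mem_bijDigits (hn : 0 < n) {t d : ℕ} (hd : d ∈ bijDigits n t) : d < n := by
  induction t using Nat.strong_induction_on with
  | _ t ih =>
  cases t with
  | zero => simp [bijDigits] at hd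
  | succ t =>
    rw [bijDigits_succ, List.mem_cons] at hd
    rcases hd with rfl | hd
    · exact Nat.mod_lt _ hn
    · exact ih _ (Nat.lt_succ_of_le (Nat.div_le_self _ _)) hd

theorem sum_count_bijDigits (hn : 0 < n) (t : ℕ) :
    ∑ i : Fin n, (bijDigits n t).count (i : ℕ) = (bijDigits n t).length := by
  rw [Fin.sum_univ_eq_sum_range fun i => (bijDigits n t).count i, ← Multiset.coe_card]
  simp only [← Multiset.coe_count]
  exact Multiset.sum_count_eq_card fun d hd => Finset.mem_range.mpr (lt_of_mem_bijDigits hn hd)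

theorem exists_bijDigits_eq {l : List ℕ} (hl : ∀ d ∈ l, d < n) :
    ∃ t < (n + 1) ^ l.length, bijDigits n t = l := by
  induction l with
  | nil => exact ⟨0, by simp, by simp [bijDigits]⟩
  | cons d l ih =>
    obtain ⟨t, ht, rfl⟩ := ih fun d' hd' => hl d' (List.mem_cons_of_mem d hd')
    have hd : d < n := hl d List.mem_cons_self
    refine ⟨n * t + d + 1, ?_, ?_⟩
    · calc n * t + d + 1 < (n + 1) * (t + 1) := by lia
        _ ≤ (n + 1) ^ ((bijDigits n t).length + 1) := by
          rw [pow_succ']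
          gcongr
          exact ht
    · rw [bijDigits_succ, Nat.mul_add_mod, Nat.mod_eq_of_lt hd, Nat.mul_add_div (by lia),
        Nat.div_eq_of_lt hd, add_zero]

theorem exists_count_bijDigits_eq (a : Fin n → ℕ) :
    ∃ t < (n + 1) ^ ∑ i, a i, ∀ i : Fin n, (bijDigits n t).count (i : ℕ) = a i := by
  let m : Multiset ℕ := ∑ i, Multiset.replicate (a i) (i : ℕ)
  have hm : ∀ d ∈ m.toList, d < n := fun d hd => by
    obtain ⟨i, -, hi⟩ := Multiset.mem_sum.mp (Multiset.mem_toList.mp hd)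
    exact Multiset.eq_of_mem_replicate hi ▸ i.2
  obtain ⟨t, ht, htm⟩ := exists_bijDigits_eq hm
  refine ⟨t, by simpa [m] using ht, fun i => ?_⟩
  rw [htm, ← Multiset.coe_count, Multiset.coe_toList, Multiset.count_sum']
  simp [Multiset.count_replicate, ← Fin.ext_iff]

end Numerals

section GraphSearch

variable {V : Type*} {G : SimpleGraph V} {v₀ : V} {S S' : Set V} {j : ℕ}

/-- `S` is a possible set of visited vertices after `j` rounds of a graph search from `v₀`: all its
elements can be reached from `v₀`, and it contains the ball of radius `j` around `v₀`. -/
structure IsSearchSet (G : SimpleGraph V) (v₀ : V) (j : ℕ) (S : Set V) : Prop where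
  reachable_of_mem : ∀ v ∈ S, G.Reachable v₀ v
  mem_of_walk : ∀ v, ∀ w : G.Walk v₀ v, w.length ≤ j → v ∈ S

namespace IsSearchSet

theorem singleton (G : SimpleGraph V) (v₀ : V) : IsSearchSet G v₀ 0 {v₀} where
  reachable_of_mem _ hv := hv ▸ .rfl
  mem_of_walk _ w hw := (w.eq_of_length_eq_zero (Nat.le_zero.mp hw)).symm

theorem succ (h : IsSearchSet G v₀ j S) (hS : S ⊆ S')
    (hadj : ∀ u ∈ S, G.neighborSet u ⊆ S') (hreach : ∀ v ∈ S', G.Reachable v₀ v) :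
    IsSearchSet G v₀ (j + 1) S' where
  reachable_of_mem := hreach
  mem_of_walk v w hw := by
    induction w using SimpleGraph.Walk.concatRec with
    | Hnil => exact hS (h.mem_of_walk _ .nil j.zero_le)
    | Hconcat w hlast _ =>
      rw [SimpleGraph.Walk.length_concat, add_le_add_iff_right] at hw
      exact hadj _ (h.mem_of_walk _ w hw) hlast

theorem connected_iff [Fintype V] (h : IsSearchSet G v₀ j S) (hj : Fintype.card V ≤ j) :
    G.Connected ↔ ∀ v, v ∈ S := by
  rw [SimpleGraph.connected_iff_exists_forall_reachable]
  refine ⟨fun ⟨u, hu⟩ v => ?_, fun hS => ⟨v₀, fun v => h.reachable_of_mem v (hS v)⟩⟩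
  obtain ⟨w, hw⟩ := ((hu v₀).symm.trans (hu v)).exists_isPath
  exact h.mem_of_walk v w (hw.length_lt.le.trans hj)

end IsSearchSet

end GraphSearch

namespace RealRAM

section Runs

/-- Total correctness with a time bound: started in `s`, the program halts within `b` steps in a
state that satisfies `Q`. -/
def Runs (p : Prog) (s : State) (b : ℕ) (Q : State → Prop) : Prop :=
  ∃ s' k, Exec p s s' k ∧ k ≤ b ∧ Q s'

namespace Runs

variable {p p' : Prog} {s : State} {b c : ℕ} {Q R : State → Prop} {t : Test}

theorem mono (h : Runs p s b Q) (hb : b ≤ c) (hQ : ∀ s', Q s' → R s') : Runs p s c R := by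
  obtain ⟨s', k, hk, hkb, hs⟩ := h
  exact ⟨s', k, hk, hkb.trans hb, hQ s' hs⟩

theorem skip (h : Q s) : Runs .skip s 1 Q := ⟨s, 1, .skip s, le_rfl, h⟩

theorem instr {i : Instr} (h : Q (i.apply s)) : Runs (.instr i) s 1 Q :=
  ⟨_, 1, .instr i s, le_rfl, h⟩

theorem seq (h : Runs p s b R) (h' : ∀ s', R s' → Runs p' s' c Q) :
    Runs (.seq p p') s (b + c) Q := by
  obtain ⟨s', k, hk, hkb, hs'⟩ := h
  obtain ⟨s'', l, hl, hlc, hs''⟩ := h' s' hs'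
  exact ⟨s'', k + l, hk.seq hl, Nat.add_le_add hkb hlc, hs''⟩

theorem instr_seq {i : Instr} (h : Runs p (i.apply s) b Q) : Runs (.seq (.instr i) p) s (1 + b) Q :=
  .seq (R := (· = i.apply s)) (.instr rfl) fun _ hs => hs ▸ h

theorem cond (h₁ : t.Holds s → Runs p s b Q) (h₂ : ¬t.Holds s → Runs p' s b Q) :
    Runs (.cond t p p') s (b + 1) Q := by
  by_cases ht : t.Holds s
  · obtain ⟨s', k, hk, hkb, hs⟩ := h₁ ht
    exact ⟨s', k + 1, .cond_true ht hk, Nat.succ_le_succ hkb, hs⟩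
  · obtain ⟨s', k, hk, hkb, hs⟩ := h₂ ht
    exact ⟨s', k + 1, .cond_false ht hk, Nat.succ_le_succ hkb, hs⟩

theorem loop (I : ℕ → State → Prop) (N : ℕ) (hinit : I 0 s)
    (hstep : ∀ j s', I j s' → t.Holds s' → j < N ∧ Runs p s' b (I (j + 1))) :
    Runs (.loop t p) s (N * (b + 1) + 1) fun s' => ∃ j, I j s' ∧ ¬t.Holds s' := by
  suffices h : ∀ m j s', j + m = N → I j s' →
      Runs (.loop t p) s' (m * (b + 1) + 1) fun s'' => ∃ j, I j s'' ∧ ¬t.Holds s'' from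
    h N 0 s (zero_add N) hinit
  intro m
  induction m with
  | zero =>
    intro j s' hj hI
    have ht : ¬t.Holds s' := fun ht => (hstep j s' hI ht).1.ne (by lia)
    exact ⟨s', 1, .loop_done ht, by lia, j, hI, ht⟩
  | succ m ih =>
    intro j s' hj hI
    by_cases ht : t.Holds s'
    · obtain ⟨s₁, k, hk, hkb, h₁⟩ := (hstep j s' hI ht).2
      obtain ⟨s₂, l, hl, hlb, h₂⟩ := ih (j + 1) s₁ (by lia) h₁
      exact ⟨s₂, k + l + 1, .loop_step ht hk hl, by lia, h₂⟩
    · exact ⟨s', 1, .loop_done ht, by lia, j, hI, ht⟩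

end Runs

/-- The program that executes the instructions of a list one after the other. -/
def block : List Instr → Prog
  | [] => .skip
  | i :: l => .seq (.instr i) (block l)

variable {s : State} {Q : State → Prop}

theorem Runs.block {l : List Instr} (h : Q (l.foldl (fun s i => i.apply s) s)) :
    Runs (block l) s (l.length + 1) Q := by
  induction l generalizing s with
  | nil => exact .skip h
  | cons i l ih =>
    rw [List.length_cons, add_comm]
    exact .instr_seq (ih h)

theorem Runs.block_seq {l : List Instr} {p : Prog} {b : ℕ}
    (h : Runs p (l.foldl (fun s i => i.apply s) s) b Q) :
    Runs (.seq (RealRAM.block l) p) s (l.length + 1 + b) Q :=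
  .seq (R := (· = l.foldl (fun s i => i.apply s) s)) (.block rfl) fun _ hs => hs ▸ h

/-- The loop that runs `p` with the values `n - 1, …, 0` of the index register `a`, where `n` is
the content of the index register `0` and the index register `1` holds `1`. -/
def forDown (a : ℕ) (p : Prog) : Prog :=
  .seq (.instr (.imove a 0)) (.loop (.ile 1 a) (.seq (.instr (.isub a a 1)) p))

theorem Runs.forDown {a : ℕ} {p : Prog} {b n : ℕ} (I : ℕ → State → Prop) (hn : s.idx 0 = n)
    (hone : ∀ i s', I i s' → s'.idx 1 = 1)
    (hupdate : ∀ i x s', I i s' → I i { s' with idx := Function.update s'.idx a x })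
    (hinit : I n s)
    (hstep : ∀ (i : Fin n) s', s'.idx a = (i : ℕ) → I (i + 1) s' →
      Runs p s' b fun s'' => s''.idx a = (i : ℕ) ∧ I i s'') :
    Runs (forDown a p) s (n * (b + 2) + 2) (I 0) := by
  rw [show n * (b + 2) + 2 = 1 + (n * (1 + b + 1) + 1) by ring]
  have hupdate_self : ∀ (s' : State) x, Function.update s'.idx a x a = x :=
    fun s' x => Function.update_self ..
  refine .instr_seq ((Runs.loop (fun j s' => j ≤ n ∧ s'.idx a = n - j ∧ I (n - j) s') n
    ⟨n.zero_le, hn ▸ hupdate_self s _, hupdate _ _ _ hinit⟩ ?_).mono le_rfl ?_)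
  · rintro j s' ⟨hj, ha, hI⟩ ht
    rw [Test.Holds, hone _ _ hI, ha] at ht
    refine ⟨by lia, .instr_seq ?_⟩
    have hsub : s'.idx a - s'.idx 1 = n - (j + 1) := by rw [ha, hone _ _ hI, Nat.sub_sub]
    have hI' : I (n - (j + 1) + 1) s' := by rwa [show n - (j + 1) + 1 = n - j by lia]
    exact (hstep ⟨n - (j + 1), by lia⟩ _ ((hupdate_self s' _).trans hsub)
      (hupdate _ _ _ hI')).mono le_rfl fun s'' h => ⟨by lia, h⟩
  · rintro s' ⟨j, ⟨hj, ha, hI⟩, ht⟩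
    rw [Test.Holds, hone _ _ hI, ha] at ht
    rwa [show n - j = 0 by lia] at hI

end Runs

open Instr Test Prog

/-- The registers and the real memory between two parts of the program: the number of points, the
constant `1`, the counter `t`, the constant `0` and the address of the radii; the unit of length
`μ` and the real `0`; the points `P` and the radii `r`. It is a conjunction rather than a structure
because then an instruction that changes none of these preserves it by definition. -/
def Setup {n : ℕ} (P : Fin n → EuclideanSpace ℝ (Fin 2)) (μ : ℝ) (t : ℕ) (r : Fin n → ℝ)
    (s : State) : Prop :=
  (s.idx 0 = n ∧ s.idx 1 = 1 ∧ s.idx 2 = t ∧ s.idx 4 = 0 ∧ s.idx 5 = 2 * n) ∧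
    (s.reg 1 = μ ∧ s.reg 2 = 0) ∧
    ∀ i : Fin n, s.rmem (2 * i) = P i 0 ∧ s.rmem (2 * i + 1) = P i 1 ∧ s.rmem (2 * n + i) = r i

variable {n : ℕ} {P : Fin n → EuclideanSpace ℝ (Fin 2)} {μ : ℝ} {t : ℕ} {r : Fin n → ℝ}
  {s : State}

theorem Setup.output_eq (h : Setup P μ t r s) : output n s = r :=
  funext fun i => (h.2.2 i).2.2

theorem Setup.update_radius (h : Setup P μ t r s) (i : Fin n) (x : ℝ) {a : ℕ}
    (ha : a = 2 * n + i) : Setup P μ t (Function.update r i x)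
      { s with rmem := Function.update s.rmem a x } := by
  subst ha
  refine ⟨h.1, h.2.1, fun j => ?_⟩
  obtain ⟨hx, hy, hr⟩ := h.2.2 j
  refine ⟨(Function.update_of_ne (by lia) ..).trans hx,
    (Function.update_of_ne (by lia) ..).trans hy, ?_⟩
  obtain rfl | hji := eq_or_ne j i
  · simp only [Function.update_self]
  · rw [Function.update_of_ne hji]
    exact (Function.update_of_ne (by lia) ..).trans hr

section TrialRadii

/-- The program that sets all radii to zero. -/
def clearRadii : Prog := forDown 6 (block [iadd 7 5 6, rstore 7 2])

theorem runs_clearRadii (hs : Setup P μ t r s) :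
    Runs clearRadii s (n * 5 + 2) (Setup P μ t 0) := by
  refine .mono (.forDown (fun i => Setup P μ t fun j : Fin n => if (j : ℕ) < i then r j else 0)
    hs.1.1 (fun _ _ h => h.1.2.1) (fun _ _ _ h => h) (by simpa using hs) ?_) le_rfl
    fun _ h => h
  intro i s' h6 hs'
  have hclear : Function.update (fun j : Fin n => if (j : ℕ) < i + 1 then r j else 0) i (s'.reg 2) =
      fun j : Fin n => if (j : ℕ) < i then r j else 0 := by
    ext j
    obtain rfl | hji := eq_or_ne j i
    · simp [hs'.2.1.2]
    · rw [Function.update_of_ne hji]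
      exact if_congr (by lia) rfl rfl
  exact .block ⟨h6, hclear ▸ hs'.update_radius i _ (congrArg₂ _ hs'.1.2.2.2.2 h6)⟩

/-- The program that divides the content of index register `8` by the number of points. -/
def divide : Prog := .seq (.instr (iconst 9 0)) (.loop (ile 0 8) (block [isub 8 8 0, iadd 9 9 1]))

theorem runs_divide [NeZero n] (hs : Setup P μ t r s) :
    Runs divide s (s.idx 8 * 4 + 2) fun s' =>
      Setup P μ t r s' ∧ s'.idx 8 = s.idx 8 % n ∧ s'.idx 9 = s.idx 8 / n := by
  rw [show s.idx 8 * 4 + 2 = 1 + (s.idx 8 * (3 + 1) + 1) by ring]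
  refine .instr_seq (.mono (.loop (fun j s' => Setup P μ t r s' ∧ s'.idx 8 + n * j = s.idx 8 ∧
    s'.idx 9 = j) (s.idx 8) ⟨hs, rfl, rfl⟩ ?_) le_rfl ?_)
  · rintro j s' ⟨hs', h8, h9⟩ ht
    obtain ⟨h0, h1, -⟩ := hs'.1
    have hn : 0 < n := NeZero.pos n
    have hnj : j ≤ n * j := Nat.le_mul_of_pos_left j hn
    replace ht : n ≤ s'.idx 8 := h0 ▸ ht
    refine ⟨by lia, .block ⟨hs', ?_, congrArg₂ _ h9 h1⟩⟩
    change s'.idx 8 - s'.idx 0 + n * (j + 1) = s.idx 8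
    rw [h0]
    lia
  · rintro s' ⟨j, ⟨hs', h8, h9⟩, ht⟩
    replace ht : s'.idx 8 < n := hs'.1.1 ▸ not_le.mp ht
    refine ⟨hs', ?_, ?_⟩
    · rw [← h8, Nat.add_mul_mod_self_left, Nat.mod_eq_of_lt ht]
    · rw [← h8, Nat.add_mul_div_left _ _ (NeZero.pos n), Nat.div_eq_of_lt ht, h9, zero_add]

/-- The radii that are tried for the value `t` of the counter. -/
def trialRadii (n : ℕ) (μ : ℝ) (t : ℕ) (i : Fin n) : ℝ := μ * (bijDigits n t).count (i : ℕ)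

theorem trialRadii_nonneg (hμ : 0 ≤ μ) (t : ℕ) (i : Fin n) : 0 ≤ trialRadii n μ t i :=
  mul_nonneg hμ (Nat.cast_nonneg _)

theorem trialRadii_zero (n : ℕ) (μ : ℝ) : trialRadii n μ 0 = 0 :=
  funext fun i => by simp [trialRadii, bijDigits]

theorem trialRadii_succ (n : ℕ) [NeZero n] (μ : ℝ) (t : ℕ) :
    trialRadii n μ (t + 1) = Pi.single (Fin.ofNat n t) μ + trialRadii n μ (t / n) := by
  ext i
  simp only [trialRadii, bijDigits_succ, Pi.add_apply, List.count_cons, beq_iff_eq]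
  obtain rfl | hi := eq_or_ne i (Fin.ofNat n t)
  · rw [Pi.single_eq_same, if_pos (Fin.val_ofNat ..).symm]
    push_cast
    ring
  · have hmod : t % n ≠ i := fun h => hi (Fin.ext h.symm)
    rw [Pi.single_eq_of_ne hi, if_neg hmod, add_zero, zero_add]

/-- The program that adds one unit to the radius selected by the least significant digit of index
register `8`, and removes this digit. -/
def addDigit : Prog :=
  .seq (.instr (isub 8 8 1)) (.seq divide
    (block [iadd 7 5 8, rload 3 7, radd 3 3 1, rstore 7 3, imove 8 9]))

theorem runs_addDigit [NeZero n] (hs : Setup P μ t r s) {w : ℕ} (hw : s.idx 8 = w + 1) :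
    Runs addDigit s (w * 4 + 9) fun s' =>
      Setup P μ t (r + Pi.single (Fin.ofNat n w) μ) s' ∧ s'.idx 8 = w / n := by
  rw [show w * 4 + 9 = 1 + ((w * 4 + 2) + 6) by ring]
  have hsub : s.idx 8 - s.idx 1 = w := by rw [hw, hs.1.2.1, Nat.add_sub_cancel]
  have hdivide := runs_divide (s := (isub 8 8 1).apply s) hs
  rw [show ((isub 8 8 1).apply s).idx 8 = w from hsub] at hdivide
  refine .instr_seq (hdivide.seq ?_)
  rintro s' ⟨hs', h8, h9⟩
  have haddr : s'.idx 5 + s'.idx 8 = 2 * n + Fin.ofNat n w := congrArg₂ _ hs'.1.2.2.2.2 h8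
  have hrad : s'.rmem (s'.idx 5 + s'.idx 8) + s'.reg 1 = r (Fin.ofNat n w) + μ := by
    rw [haddr, (hs'.2.2 _).2.2, hs'.2.1.1]
  have hupdate : Function.update r (Fin.ofNat n w) (s'.rmem (s'.idx 5 + s'.idx 8) + s'.reg 1) =
      r + Pi.single (Fin.ofNat n w) μ := by
    ext k
    obtain rfl | hk := eq_or_ne k (Fin.ofNat n w)
    · rw [Function.update_self, Pi.add_apply, Pi.single_eq_same, hrad]
    · rw [Function.update_of_ne hk, Pi.add_apply, Pi.single_eq_of_ne hk, add_zero]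
  exact .block ⟨hupdate ▸ hs'.update_radius _ _ haddr, h9⟩

/-- The program that adds one unit to a radius for every digit of the counter. -/
def addDigits : Prog := .seq (.instr (imove 8 2)) (.loop (ile 1 8) addDigit)

theorem runs_addDigits [NeZero n] (hs : Setup P μ t 0 s) :
    Runs addDigits s (t * (t * 4 + 10) + 2) (Setup P μ t (trialRadii n μ t)) := by
  rw [show t * (t * 4 + 10) + 2 = 1 + (t * (t * 4 + 9 + 1) + 1) by ring]
  refine .instr_seq (.mono (.loop (fun j s' => s'.idx 8 + j ≤ t ∧
    ∃ r, Setup P μ t r s' ∧ r + trialRadii n μ (s'.idx 8) = trialRadii n μ t) t ?_ ?_) le_rfl ?_)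
  · exact ⟨hs.1.2.2.1.le, 0, hs, (zero_add _).trans (congrArg _ hs.1.2.2.1)⟩
  · rintro j s' ⟨hj, r, hs', hr⟩ ht
    replace ht : 1 ≤ s'.idx 8 := hs'.1.2.1 ▸ ht
    obtain ⟨w, hw⟩ := Nat.exists_eq_add_of_le' ht
    refine ⟨by lia, (runs_addDigit hs' hw).mono (by lia) ?_⟩
    rintro s'' ⟨hs'', h8⟩
    have hdiv := Nat.div_le_self w n
    refine ⟨by lia, _, hs'', ?_⟩
    rw [← hr, hw, h8, trialRadii_succ, add_assoc]
  · rintro s' ⟨j, ⟨-, r, hs', hr⟩, ht⟩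
    have h8 : s'.idx 8 = 0 := Nat.lt_one_iff.mp (hs'.1.2.1 ▸ not_le.mp ht)
    rw [h8, trialRadii_zero, add_zero] at hr
    exact hr ▸ hs'

end TrialRadii

section ConnectivityTest

/-- The disks with a nonzero mark in the index memory. -/
def marked (n : ℕ) (s : State) : Set (Fin n) := {v | 1 ≤ s.imem v}

theorem marked_update {i : Fin n} {a x : ℕ} (ha : a = i) (hx : x = 1) :
    marked n { s with imem := Function.update s.imem a x } = insert i (marked n s) := by
  subst ha hx
  ext v
  obtain rfl | hv := eq_or_ne v i
  · simp [marked]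
  · simp [marked, hv, Fin.val_ne_of_ne hv]

/-- The program that marks the disk in index register `8` if it intersects the disk in index
register `7`. -/
def markIfAdj : Prog :=
  .seq (block [iadd 9 7 7, iadd 10 8 8, rload 3 9, rload 4 10, rsub 3 3 4, rmul 3 3 3,
    iadd 9 9 1, iadd 10 10 1, rload 4 9, rload 5 10, rsub 4 4 5, rmul 4 4 4, radd 3 3 4,
    iadd 9 5 7, iadd 10 5 8, rload 4 9, rload 5 10, radd 4 4 5, rmul 4 4 4])
  (.cond (rle 3 4) (.instr (istore 8 1)) .skip)

theorem dist_le_iff_mul_self_add_mul_self_le {p p' : EuclideanSpace ℝ (Fin 2)} {d : ℝ}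
    (hd : 0 ≤ d) : dist p p' ≤ d ↔
      (p 0 - p' 0) * (p 0 - p' 0) + (p 1 - p' 1) * (p 1 - p' 1) ≤ d * d := by
  rw [EuclideanSpace.dist_eq, Real.sqrt_le_left hd, Fin.sum_univ_two, Real.dist_eq, Real.dist_eq,
    sq_abs, sq_abs, sq, sq, sq]

variable {u v : Fin n}

theorem runs_markIfAdj (hr : ∀ i, 0 ≤ r i) (hs : Setup P μ t r s) (hu : s.idx 7 = u)
    (hv : s.idx 8 = v) (hmark : u ∈ marked n s) :
    Runs markIfAdj s 22 fun s' => (s'.idx 6 = s.idx 6 ∧ s'.idx 7 = u ∧ s'.idx 8 = v) ∧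
      Setup P μ t r s' ∧
      marked n s' = marked n s ∪ {x | x = v ∧ (connectivityGraph P r).Adj u v} := by
  obtain ⟨-, h1, -, -, h5⟩ := hs.1
  refine .block_seq (b := 2) ?_
  set s' := List.foldl _ _ _ with hs'_def
  have htest : (rle 3 4).Holds s' ↔ dist (P u) (P v) ≤ r u + r v := by
    rw [dist_le_iff_mul_self_add_mul_self_le (add_nonneg (hr u) (hr v))]
    simp [hs'_def, Holds, Instr.apply, hu, hv, h1, h5, ← two_mul, hs.2.2]
  refine .cond (fun h => .instr ⟨⟨rfl, hu, hv⟩, hs, ?_⟩) fun h => .skip ⟨⟨rfl, hu, hv⟩, hs, ?_⟩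
  · have hmarked : marked n ((istore 8 1).apply s') = insert v (marked n s) := marked_update hv h1
    rw [hmarked]
    ext x
    simp only [connectivityGraph, ← htest, h, and_true, Set.mem_insert_iff, Set.mem_union,
      Set.mem_ofPred_eq]
    grind
  · have hmarked : marked n s' = marked n s := rfl
    rw [hmarked]
    ext x
    simp [connectivityGraph, ← htest, h]

/-- The program that marks the neighbours of the disk in index register `7`. -/
def markNeighbors : Prog := forDown 8 markIfAdj

theorem runs_markNeighbors (hr : ∀ i, 0 ≤ r i) (hs : Setup P μ t r s) (hu : s.idx 7 = u)
    (hmark : u ∈ marked n s) :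
    Runs markNeighbors s (n * 24 + 2) fun s' => (s'.idx 6 = s.idx 6 ∧ s'.idx 7 = u) ∧
      Setup P μ t r s' ∧ marked n s' = marked n s ∪ (connectivityGraph P r).neighborSet u := by
  refine .mono (.forDown (fun i s' => (s'.idx 6 = s.idx 6 ∧ s'.idx 7 = u) ∧ Setup P μ t r s' ∧
      marked n s' = marked n s ∪ {x | i ≤ x ∧ (connectivityGraph P r).Adj u x})
    hs.1.1 (fun _ _ h => h.2.1.1.2.1) (fun _ _ _ h => h) ⟨⟨rfl, hu⟩, hs, ?_⟩ ?_) le_rfl ?_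
  · exact (Set.union_eq_self_of_subset_right fun x hx => absurd x.2 hx.1.not_gt).symm
  · rintro v s' h8 ⟨⟨h6, h7⟩, hs', hmarked⟩
    refine (runs_markIfAdj hr hs' h7 h8 (hmarked ▸ .inl hmark)).mono le_rfl ?_
    rintro s'' ⟨⟨h6', h7', h8'⟩, hs'', hmarked'⟩
    refine ⟨h8', ⟨h6'.trans h6, h7'⟩, hs'', ?_⟩
    rw [hmarked', hmarked, Set.union_assoc]
    congr 1
    ext x
    simp only [Set.mem_union, Set.mem_ofPred_eq]
    grind
  · rintro s' ⟨h, hs', hmarked⟩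
    refine ⟨h, hs', hmarked.trans ?_⟩
    simp only [zero_le, true_and]
    rfl

/-- The program that marks the neighbours of the disk in index register `7` if this disk is
marked. -/
def visit : Prog := .seq (.instr (iload 9 7)) (.cond (ile 1 9) markNeighbors .skip)

theorem runs_visit (hr : ∀ i, 0 ≤ r i) (hs : Setup P μ t r s) (hu : s.idx 7 = u) :
    Runs visit s (n * 24 + 4) fun s' => (s'.idx 6 = s.idx 6 ∧ s'.idx 7 = u) ∧
      Setup P μ t r s' ∧
      marked n s' = marked n s ∪ {x | u ∈ marked n s ∧ (connectivityGraph P r).Adj u x} := by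
  rw [show n * 24 + 4 = 1 + ((n * 24 + 2) + 1) by ring]
  have htest : (ile 1 9).Holds ((iload 9 7).apply s) ↔ u ∈ marked n s := by
    change s.idx 1 ≤ s.imem (s.idx 7) ↔ 1 ≤ s.imem u
    rw [hs.1.2.1, hu]
  refine .instr_seq (.cond (fun h => ?_) fun h => .mono (.skip ?_) (by lia) fun _ => id)
  · refine (runs_markNeighbors (s := (iload 9 7).apply s) hr hs hu (htest.mp h)).mono le_rfl ?_
    rintro s' ⟨hidx, hs', hmarked⟩
    refine ⟨hidx, hs', hmarked.trans ?_⟩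
    simp only [htest.mp h, true_and]
    rfl
  · refine ⟨⟨rfl, hu⟩, hs, ?_⟩
    simp only [mt htest.mpr h, false_and, Set.ofPred_false, Set.union_empty]
    rfl

/-- The program that marks the neighbours of all marked disks. -/
def markRound : Prog := forDown 7 visit

theorem runs_markRound (hr : ∀ i, 0 ≤ r i) (hs : Setup P μ t r s) {v₀ : Fin n} {j : ℕ}
    (hS : IsSearchSet (connectivityGraph P r) v₀ j (marked n s)) :
    Runs markRound s (n * (n * 24 + 6) + 2) fun s' => s'.idx 6 = s.idx 6 ∧ Setup P μ t r s' ∧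
      IsSearchSet (connectivityGraph P r) v₀ (j + 1) (marked n s') := by
  refine .mono (.forDown (fun i s' => s'.idx 6 = s.idx 6 ∧ Setup P μ t r s' ∧
      marked n s ⊆ marked n s' ∧
      (∀ u ∈ marked n s, i ≤ u → (connectivityGraph P r).neighborSet u ⊆ marked n s') ∧
      ∀ v ∈ marked n s', (connectivityGraph P r).Reachable v₀ v)
    hs.1.1 (fun _ _ h => h.2.1.1.2.1) (fun _ _ _ h => h)
    ⟨rfl, hs, subset_rfl, fun u _ hu => absurd u.2 hu.not_gt, hS.reachable_of_mem⟩ ?_) le_rfl ?_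
  · rintro u s' h7 ⟨h6, hs', hsub, hadj, hreach⟩
    refine (runs_visit hr hs' h7).mono le_rfl ?_
    rintro s'' ⟨⟨h6', h7'⟩, hs'', hmarked⟩
    rw [hmarked]
    refine ⟨h7', h6'.trans h6, hs'', hsub.trans Set.subset_union_left, fun x hx hux => ?_, ?_⟩
    · obtain rfl | hne := eq_or_ne x u
      · exact fun y hy => .inr ⟨hsub hx, hy⟩
      · exact (hadj x hx (by lia)).trans Set.subset_union_left
    · rintro x (hx | ⟨hu, hux⟩)
      · exact hreach x hx
      · exact (hreach u hu).trans hux.reachable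
  · rintro s' ⟨h6, hs', hsub, hadj, hreach⟩
    exact ⟨h6, hs', hS.succ hsub (fun u hu => hadj u hu (Nat.zero_le _)) hreach⟩

/-- The program that removes all marks. -/
def unmark : Prog := forDown 6 (block [istore 6 4])

theorem runs_unmark (hs : Setup P μ t r s) :
    Runs unmark s (n * 4 + 2) fun s' => Setup P μ t r s' ∧ marked n s' = ∅ := by
  refine .mono (.forDown (fun i s' => Setup P μ t r s' ∧ ∀ v ∈ marked n s', (v : ℕ) < i)
    hs.1.1 (fun _ _ h => h.1.1.2.1) (fun _ _ _ h => h) ⟨hs, fun v _ => v.2⟩ ?_) le_rfl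
    fun s' h => ⟨h.1, Set.eq_empty_of_forall_notMem fun v hv => Nat.not_lt_zero _ (h.2 v hv)⟩
  rintro i s' h6 ⟨hs', hmarked⟩
  refine .block ⟨h6, hs', fun v hv => ?_⟩
  change 1 ≤ Function.update s'.imem (s'.idx 6) (s'.idx 4) v at hv
  rw [h6, hs'.1.2.2.2.1] at hv
  have hvi : (v : ℕ) ≠ i := by
    intro h
    simp [h] at hv
  rw [Function.update_of_ne hvi] at hv
  have := hmarked v hv
  lia

/-- The program that sets index register `3` to `1` if all disks are marked, and to `0`
otherwise. -/
def testMarks : Prog :=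
  .seq (.instr (iconst 3 1))
    (forDown 6 (.seq (.instr (iload 9 6)) (.cond (ile 1 9) .skip (.instr (iconst 3 0)))))

theorem runs_testMarks (hs : Setup P μ t r s) :
    Runs testMarks s (n * 5 + 3) fun s' =>
      Setup P μ t r s' ∧ (s'.idx 3 ≠ 0 ↔ ∀ v, v ∈ marked n s) := by
  rw [show n * 5 + 3 = 1 + (n * (3 + 2) + 2) by ring]
  refine .instr_seq (.mono (.forDown (fun i s' => Setup P μ t r s' ∧ marked n s' = marked n s ∧
      (s'.idx 3 ≠ 0 ↔ ∀ v : Fin n, i ≤ v → v ∈ marked n s))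
    hs.1.1 (fun _ _ h => h.1.1.2.1) (fun _ _ _ h => h) ⟨hs, rfl, ?_⟩ ?_) le_rfl ?_)
  · exact ⟨fun _ v hv => absurd v.2 hv.not_gt, fun _ => one_ne_zero⟩
  · rintro i s' h6 ⟨hs', hmarked, h3⟩
    have htest : (ile 1 9).Holds ((iload 9 6).apply s') ↔ i ∈ marked n s := by
      rw [← hmarked]
      change s'.idx 1 ≤ s'.imem (s'.idx 6) ↔ 1 ≤ s'.imem i
      rw [hs'.1.2.1, h6]
    refine .instr_seq (b := 2) (.cond (fun h => .skip ⟨h6, hs', hmarked, h3.trans ?_⟩) fun h =>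
      .instr ⟨h6, hs', hmarked, fun h => absurd rfl h, fun hall => ?_⟩)
    · refine ⟨fun hall v hv => ?_, fun hall v hv => hall v (by lia)⟩
      obtain rfl | hne := eq_or_ne v i
      · exact htest.mp h
      · exact hall v (by lia)
    · exact absurd (htest.mpr (hall i le_rfl)) h
  · rintro s' ⟨hs', -, h3⟩
    exact ⟨hs', h3.trans ⟨fun h v => h v (Nat.zero_le _), fun h v _ => h v⟩⟩

/-- The program that sets index register `3` to a nonzero value if and only if the graph of the
disks is connected. -/
def testConnected : Prog :=
  .seq unmark (.seq (.instr (istore 4 1)) (.seq (forDown 6 markRound) testMarks))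

theorem runs_testConnected [NeZero n] (hr : ∀ i, 0 ≤ r i) (hs : Setup P μ t r s) :
    Runs testConnected s (n * (n * (n * 24 + 6) + 4) + n * 9 + 8) fun s' =>
      Setup P μ t r s' ∧ (s'.idx 3 ≠ 0 ↔ (connectivityGraph P r).Connected) := by
  rw [show n * (n * (n * 24 + 6) + 4) + n * 9 + 8 =
    (n * 4 + 2) + (1 + ((n * ((n * (n * 24 + 6) + 2) + 2) + 2) + (n * 5 + 3))) by ring]
  refine (runs_unmark hs).seq ?_
  rintro s₁ ⟨hs₁, hempty⟩
  have hroot : marked n ((istore 4 1).apply s₁) = {0} := by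
    rw [← insert_empty_eq, ← hempty]
    exact marked_update (hs₁.1.2.2.2.1.trans (Fin.val_zero n).symm) hs₁.1.2.1
  refine .instr_seq (.seq (.forDown (fun i s' => Setup P μ t r s' ∧ ∃ j, n ≤ i + j ∧
      IsSearchSet (connectivityGraph P r) 0 j (marked n s'))
    hs₁.1.1 (fun _ _ h => h.1.1.2.1) (fun _ _ _ h => h) ⟨hs₁, 0, le_rfl, ?_⟩ ?_) ?_)
  · exact hroot ▸ .singleton _ _
  · rintro i s' h6 ⟨hs', j, hj, hS⟩
    refine (runs_markRound hr hs' hS).mono le_rfl ?_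
    rintro s'' ⟨h6', hs'', hS'⟩
    exact ⟨h6'.trans h6, hs'', j + 1, by lia, hS'⟩
  · rintro s₂ ⟨hs₂, j, hj, hS⟩
    refine (runs_testMarks hs₂).mono le_rfl fun s' h => ⟨h.1, h.2.trans (hS.connected_iff ?_).symm⟩
    simpa using hj

end ConnectivityTest

section Search

/-- The program that sets the radii that belong to the counter and tests whether the graph of the
disks is connected. -/
def testTrial : Prog := .seq clearRadii (.seq addDigits testConnected)

theorem runs_testTrial [NeZero n] (hμ : 0 ≤ μ) (hs : Setup P μ t r s) :
    Runs testTrial s (t * (t * 4 + 10) + n * (n * (n * 24 + 6) + 4) + n * 14 + 12) fun s' =>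
      Setup P μ t (trialRadii n μ t) s' ∧
        (s'.idx 3 ≠ 0 ↔ (connectivityGraph P (trialRadii n μ t)).Connected) := by
  rw [show t * (t * 4 + 10) + n * (n * (n * 24 + 6) + 4) + n * 14 + 12 = (n * 5 + 2) +
    ((t * (t * 4 + 10) + 2) + (n * (n * (n * 24 + 6) + 4) + n * 9 + 8)) by ring]
  exact (runs_clearRadii hs).seq fun s₁ hs₁ => (runs_addDigits hs₁).seq fun s₂ hs₂ =>
    runs_testConnected (trialRadii_nonneg hμ t) hs₂

/-- The program that increases the counter until the graph of the disks is connected. -/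
def search : Prog :=
  .seq (.instr (iconst 3 0)) (.loop (ile 3 4) (.seq testTrial (.instr (iadd 2 2 1))))

/-- The values of the counter for which the graph of the disks is connected. -/
def connectedTrials (P : Fin n → EuclideanSpace ℝ (Fin 2)) (μ : ℝ) : Set ℕ :=
  {t | (connectivityGraph P (trialRadii n μ t)).Connected}

theorem runs_search [NeZero n] (hμ : 0 ≤ μ) (hs : Setup P μ 0 r s) {T : ℕ}
    (hT : T ∈ connectedTrials P μ) :
    Runs search s ((T + 1) * (T * (T * 4 + 10) + n * (n * (n * 24 + 6) + 4) + n * 14 + 14) + 2)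
      fun s' => ∃ t, IsLeast (connectedTrials P μ) t ∧ output n s' = trialRadii n μ t := by
  rw [show ∀ k, k + 2 = 1 + (k + 1) by lia]
  refine .instr_seq (.mono (.loop (fun j s' => ∃ r, Setup P μ j r s' ∧
      (s'.idx 3 = 0 → ∀ t < j, t ∉ connectedTrials P μ) ∧
      (s'.idx 3 ≠ 0 → ∃ t, IsLeast (connectedTrials P μ) t ∧ r = trialRadii n μ t))
    (T + 1) ⟨r, hs, fun _ t ht => absurd ht t.not_lt_zero, fun h => absurd rfl h⟩ ?_) le_rfl ?_)
  · rintro j s' ⟨r', hs', hnone, -⟩ ht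
    replace ht : s'.idx 3 = 0 := Nat.le_zero.mp (hs'.1.2.2.2.1 ▸ ht)
    have hj : j ≤ T := le_of_not_gt fun h => hnone ht T h hT
    have hcost : j * (j * 4 + 10) ≤ T * (T * 4 + 10) := by gcongr
    refine ⟨Nat.lt_succ_of_le hj, .mono ((runs_testTrial hμ hs').seq fun s₁ hs₁ => .instr ?_)
      (b := _ + 1) (by lia) fun _ => id⟩
    obtain ⟨⟨⟨h0, h1, h2, hidx⟩, hmem⟩, hconn⟩ := hs₁
    refine ⟨_, ⟨⟨h0, h1, congrArg₂ _ h2 h1, hidx⟩, hmem⟩, fun h t ht' => ?_, fun h => ?_⟩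
    · obtain rfl | hlt := Nat.lt_succ_iff.mp ht' |>.eq_or_lt
      · exact fun hmem => hconn.mpr hmem h
      · exact hnone ht t hlt
    · exact ⟨j, ⟨hconn.mp h, fun t ht' => le_of_not_gt fun hlt => hnone ht t hlt ht'⟩, rfl⟩
  · rintro s' ⟨j, ⟨r', hs', -, hfound⟩, ht⟩
    obtain ⟨t, hleast, hr⟩ := hfound fun h => ht (h.trans_le (Nat.zero_le _))
    exact ⟨t, hleast, hs'.output_eq.trans hr⟩

end Search

section Initialization

theorem setup_inputState_rmem (P : Fin n → EuclideanSpace ℝ (Fin 2)) (ε : ℝ) (i : Fin n) :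
    (inputState P ε).rmem (2 * i) = P i 0 ∧ (inputState P ε).rmem (2 * i + 1) = P i 1 ∧
      (inputState P ε).rmem (2 * n + i) = 0 := by
  have hdiv : (2 * (i : ℕ) + 1) / 2 = i := by lia
  have hmod : (2 * (i : ℕ) + 1) % 2 = 1 := by lia
  have hrad : ¬(2 * n + i) / 2 < n := by lia
  simp [inputState, hdiv, hmod, hrad]

/-- The parameter `q` for which the relative error `4 / q` of the approximation is at most `ε`. -/
noncomputable def accuracy (ε : ℝ) : ℕ := ⌊4 / ε⌋₊ + 1

theorem accuracy_pos (ε : ℝ) : 0 < accuracy ε := Nat.succ_pos _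

theorem four_div_accuracy_le {ε : ℝ} (hε : 0 < ε) : 4 / (accuracy ε : ℝ) ≤ ε := by
  have haccuracy : 4 / ε < accuracy ε := by exact_mod_cast Nat.lt_floor_add_one (4 / ε)
  rw [div_lt_iff₀ hε] at haccuracy
  rw [div_le_iff₀ (by exact_mod_cast accuracy_pos ε)]
  linarith

/-- The program that prepares the registers and computes the accuracy in index register `6` and in
real register `4`. -/
def findAccuracy : Prog :=
  .seq (block [iconst 1 1, iadd 5 0 0, rmove 3 0, rconst 4 1, rconst 5 4, rconst 6 1, iconst 6 1])
    (.loop (rle 3 5) (block [radd 3 3 0, radd 4 4 6, iadd 6 6 1]))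

theorem runs_findAccuracy {ε : ℝ} (hε : 0 < ε) (P : Fin n → EuclideanSpace ℝ (Fin 2)) :
    Runs findAccuracy (inputState P ε) (accuracy ε * 5 + 9) fun s' =>
      Setup P 0 0 0 s' ∧ s'.idx 6 = accuracy ε ∧ s'.reg 4 = accuracy ε ∧ s'.reg 6 = 1 := by
  rw [show accuracy ε * 5 + 9 = 8 + (accuracy ε * (4 + 1) + 1) by ring]
  refine .block_seq (b := accuracy ε * (4 + 1) + 1) (.mono (.loop (fun j s' =>
    Setup P 0 0 0 s' ∧ s'.idx 6 = j + 1 ∧ s'.reg 0 = ε ∧ s'.reg 3 = (j + 1) * ε ∧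
      s'.reg 4 = j + 1 ∧ s'.reg 5 = 4 ∧ s'.reg 6 = 1 ∧ j * ε ≤ 4) (accuracy ε) ?_ ?_) le_rfl ?_)
  · refine ⟨⟨?_, ⟨rfl, rfl⟩, setup_inputState_rmem P ε⟩, ?_⟩
    · simp [Instr.apply, inputState, two_mul]
    · simp [Instr.apply, inputState]
  · rintro j s' ⟨hs, h6, h0, h3, h4, h5, hr6, -⟩ ht
    replace ht : (j + 1) * ε ≤ 4 := by rwa [Holds, h3, h5] at ht
    have hj : j ≤ ⌊4 / ε⌋₊ := Nat.le_floor <| by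
      rw [le_div_iff₀ hε]
      linarith
    refine ⟨Nat.lt_succ_of_le hj, .block ⟨hs, congrArg₂ _ h6 hs.1.2.1, h0, ?_, ?_, h5, hr6, ?_⟩⟩
    · simp [Instr.apply, h0, h3, add_one_mul]
    · simp [Instr.apply, h4, hr6]
    · exact_mod_cast ht
  · rintro s' ⟨j, ⟨hs, h6, -, h3, h4, h5, hr6, hj⟩, ht⟩
    rw [Holds, h3, h5, not_le] at ht
    have hfloor : accuracy ε = j + 1 := congrArg (· + 1) <| by
      rw [Nat.floor_eq_iff (by positivity), le_div_iff₀ hε, div_lt_iff₀ hε]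
      exact ⟨hj, ht⟩
    rw [hfloor]
    exact ⟨hs, h6, by exact_mod_cast h4, hr6⟩

/-- The program that computes the grid size in real register `8`. -/
def findGridSize : Prog :=
  .seq (block [radd 7 4 4, radd 7 7 6, rmove 8 4, iconst 7 0])
    (.loop (ile 7 6) (block [rmul 8 8 7, iadd 7 7 1]))

theorem runs_findGridSize {q : ℕ} (hs : Setup P μ t r s) (h6 : s.idx 6 = q) (h4 : s.reg 4 = q)
    (hr6 : s.reg 6 = 1) :
    Runs findGridSize s (q * 4 + 10) fun s' => Setup P μ t r s' ∧ s'.reg 8 = gridSize q := by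
  rw [show q * 4 + 10 = 5 + ((q + 1) * (3 + 1) + 1) by ring]
  refine .block_seq (b := (q + 1) * (3 + 1) + 1) (.mono (.loop (fun j s' => Setup P μ t r s' ∧
    s'.idx 6 = q ∧ s'.idx 7 = j ∧ s'.reg 7 = 2 * q + 1 ∧ s'.reg 8 = q * (2 * q + 1) ^ j ∧
      j ≤ q + 1) (q + 1) ⟨hs, h6, rfl, ?_⟩ ?_) le_rfl ?_)
  · simp [Instr.apply, h4, hr6, two_mul]
  · rintro j s' ⟨hs', h6, h7, hr7, hr8, hj⟩ ht
    rw [Holds, h6, h7] at ht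
    refine ⟨by lia, .block ⟨hs', h6, congrArg₂ _ h7 hs'.1.2.1, hr7, ?_, by lia⟩⟩
    simp [Instr.apply, hr7, hr8, pow_succ, mul_assoc]
  · rintro s' ⟨j, ⟨hs', h6, h7, -, hr8, hj⟩, ht⟩
    rw [Holds, h6, h7] at ht
    obtain rfl : j = q + 1 := by lia
    exact ⟨hs', hr8.trans (by push_cast [gridSize]; rfl)⟩

/-- The program that replaces the content of real register `1` by its maximum with the content of
real register `a`. -/
def maxInto (a : ℕ) : Prog := .cond (rle 1 a) (.instr (rmove 1 a)) .skip

theorem runs_maxInto (a : ℕ) : Runs (maxInto a) s 2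
    (· = { s with reg := Function.update s.reg 1 (max (s.reg 1) (s.reg a)) }) := by
  refine .cond (fun ht => .instr ?_) fun ht => .skip ?_
  · rw [max_eq_right ht]
    rfl
  · rw [max_eq_left (not_le.mp ht).le, Function.update_eq_self]

/-- The program that replaces the content of real register `1` by its maximum with the distance, in
the supremum norm, of the point with number `0` and the point selected by index register `6`. -/
def updateExtent : Prog :=
  .seq (block [iadd 7 6 6, rload 3 7, rload 4 4, rsub 3 3 4, rsub 4 2 3,
    iadd 7 7 1, rload 5 7, rload 6 1, rsub 5 5 6, rsub 6 2 5])
  (.seq (maxInto 3) (.seq (maxInto 4) (.seq (maxInto 5) (maxInto 6))))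

theorem dist_eq_max_abs (x y : Fin 2 → ℝ) : dist x y = max |x 0 - y 0| |x 1 - y 1| := by
  refine le_antisymm ((dist_pi_le_iff (by positivity)).mpr ?_)
    (max_le (dist_le_pi_dist x y 0) (dist_le_pi_dist x y 1))
  simp [Fin.forall_fin_two, Real.dist_eq]

theorem runs_updateExtent [NeZero n] (hs : Setup P μ t r s) {i : Fin n} (h6 : s.idx 6 = i) :
    Runs updateExtent s 19 fun s' => (s'.idx 6 = i ∧ s'.reg 8 = s.reg 8) ∧
      Setup P (max μ (dist (P i).ofLp (P 0).ofLp)) t r s' := by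
  refine .block_seq (b := 2 + (2 + (2 + 2))) ((runs_maxInto 3).seq ?_)
  rintro _ rfl
  refine (runs_maxInto 4).seq ?_
  rintro _ rfl
  refine (runs_maxInto 5).seq ?_
  rintro _ rfl
  refine (runs_maxInto 6).mono le_rfl ?_
  rintro _ rfl
  refine ⟨⟨h6, rfl⟩, hs.1, ⟨?_, hs.2.1.2⟩, hs.2.2⟩
  obtain ⟨hx₀, hy₀, -⟩ := hs.2.2 0
  obtain ⟨hx, hy, -⟩ := hs.2.2 i
  rw [Fin.val_zero n, mul_zero] at hx₀ hy₀
  simp [Instr.apply, h6, hs.1, hs.2.1, ← two_mul, hx₀, hy₀, hx, hy, dist_eq_max_abs, abs, max_assoc]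

theorem dist_ofLp_le_dist (x y : EuclideanSpace ℝ (Fin 2)) : dist x.ofLp y.ofLp ≤ dist x y := by
  simpa using (PiLp.lipschitzWith_ofLp 2 fun _ : Fin 2 => ℝ).dist_le_mul x y

theorem dist_le_two_mul_dist_ofLp (x y : EuclideanSpace ℝ (Fin 2)) :
    dist x y ≤ 2 * dist x.ofLp y.ofLp := by
  rw [EuclideanSpace.dist_eq, Real.sqrt_le_iff, Fin.sum_univ_two, mul_pow]
  have h₀ := pow_le_pow_left₀ dist_nonneg (dist_le_pi_dist x.ofLp y.ofLp 0) 2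
  have h₁ := pow_le_pow_left₀ dist_nonneg (dist_le_pi_dist x.ofLp y.ofLp 1) 2
  exact ⟨by positivity, by linarith [sq_nonneg (dist x.ofLp y.ofLp)]⟩

/-- The program that divides the extent of the points by real register `8`, with the result in
real register `1`. -/
def findUnit : Prog := .seq (forDown 6 updateExtent) (.instr (rdiv 1 1 8))

theorem runs_findUnit [NeZero n] (hs : Setup P 0 t r s) :
    Runs findUnit s (n * 21 + 3) fun s' =>
      ∃ M, IsExtent P 0 M ∧ Setup P (M / s.reg 8) t r s' := by
  rw [show n * 21 + 3 = (n * (19 + 2) + 2) + 1 by ring]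
  refine .seq (.forDown (fun i s' => s'.reg 8 = s.reg 8 ∧ ∃ M, Setup P M t r s' ∧
    (∀ j : Fin n, i ≤ j → dist (P j).ofLp (P 0).ofLp ≤ M) ∧ ∃ j, M ≤ dist (P 0) (P j))
    hs.1.1 (fun _ _ h => h.2.choose_spec.1.1.2.1) (fun _ _ _ h => h) ?_ ?_) ?_
  · exact ⟨rfl, 0, hs, fun j hj => absurd j.2 hj.not_gt, 0, dist_nonneg⟩
  · rintro i s' h6 ⟨h8, M, hs', hle, j, hj⟩
    refine (runs_updateExtent hs' h6).mono le_rfl ?_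
    rintro s'' ⟨⟨h6', h8'⟩, hs''⟩
    refine ⟨h6', h8'.trans h8, _, hs'', fun k hk => ?_, ?_⟩
    · obtain rfl | hne := eq_or_ne k i
      · exact le_max_right _ _
      · exact le_max_of_le_left (hle k (by lia))
    · have hi := dist_comm (P i) (P 0) ▸ dist_ofLp_le_dist (P i) (P 0)
      obtain hM | hM := max_choice M (dist (P i).ofLp (P 0).ofLp)
      · exact ⟨j, hM.trans_le hj⟩
      · exact ⟨i, hM.trans_le hi⟩
  · rintro s' ⟨h8, M, hs', hle, hM⟩
    have hdiv : s'.reg 1 / s'.reg 8 = M / s.reg 8 := congrArg₂ (· / ·) hs'.2.1.1 h8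
    refine .instr ⟨M, ⟨fun v => ?_, hM⟩, hs'.1, ⟨hdiv, hs'.2.1.2⟩, hs'.2.2⟩
    rw [dist_comm]
    linarith [dist_le_two_mul_dist_ofLp (P v) (P 0), hle v (Nat.zero_le _)]

end Initialization

section Scheme

theorem exists_mem_connectedTrials {v₀ : Fin n} {M : ℝ} (h : IsExtent P v₀ M) {q : ℕ}
    (hq : 0 < q) :
    ∃ t ≤ (n + 1) ^ (2 * gridSize q), t ∈ connectedTrials P (M / gridSize q) := by
  obtain ⟨a, hsum, ha⟩ := h.exists_sum_eq_connected hq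
  obtain ⟨t, ht, hcount⟩ := exists_count_bijDigits_eq a
  simp only [← hcount] at ha
  exact ⟨t, hsum ▸ ht.le, ha⟩

theorem sum_trialRadii_le {v₀ : Fin n} {M : ℝ} (h : IsExtent P v₀ M) {q : ℕ}
    (hq : 0 < q) (ht : IsLeast (connectedTrials P (M / gridSize q)) t) (hr : IsFeasible P r) :
    ∑ i, trialRadii n (M / gridSize q) t i ≤ (1 + 4 / q) * ∑ i, r i := by
  obtain ⟨a, ha, hsum⟩ := h.exists_sum_le_connected hq hr.1 hr.2
  obtain ⟨t', -, hcount⟩ := exists_count_bijDigits_eq a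
  have hle : t ≤ t' := ht.2 <| by
    simp only [← hcount] at ha
    exact ha
  have hcount_le : ∑ i : Fin n, (bijDigits n t).count (i : ℕ) ≤ ∑ i, a i := by
    simp only [← hcount, sum_count_bijDigits v₀.pos]
    exact length_bijDigits_mono n hle
  have hμ : 0 ≤ M / gridSize q := div_nonneg h.nonneg (Nat.cast_nonneg _)
  refine le_trans ?_ hsum
  simp only [trialRadii, ← Finset.mul_sum]
  exact mul_le_mul_of_nonneg_left (by exact_mod_cast hcount_le) hμ

/-- The approximation scheme: a single program for all `ε`, which finds `q` itself. -/
def scheme : Prog := .seq findAccuracy (.seq findGridSize (.seq findUnit search))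

/-- The bound for the number of steps of the approximation scheme for `n` points. -/
noncomputable def schemeTime (q : ℕ) : Polynomial ℕ :=
  let X : Polynomial ℕ := Polynomial.X
  let Y := (X + 1) ^ (2 * gridSize q)
  Polynomial.C (q * 5 + 9) + (Polynomial.C (q * 4 + 10) + ((X * 21 + 3) +
    ((Y + 1) * (Y * (Y * 4 + 10) + X * (X * (X * 24 + 6) + 4) + X * 14 + 14) + 2)))

theorem runs_scheme [NeZero n] {ε : ℝ} (hε : 0 < ε) (P : Fin n → EuclideanSpace ℝ (Fin 2)) :
    Runs scheme (inputState P ε) ((schemeTime (accuracy ε)).eval n) fun s' =>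
      ∃ M t, IsExtent P 0 M ∧ IsLeast (connectedTrials P (M / gridSize (accuracy ε))) t ∧
        output n s' = trialRadii n (M / gridSize (accuracy ε)) t := by
  simp only [schemeTime, Polynomial.eval_add, Polynomial.eval_mul, Polynomial.eval_pow,
    Polynomial.eval_C, Polynomial.eval_X, Polynomial.eval_one, Polynomial.eval_ofNat]
  refine (runs_findAccuracy hε P).seq ?_
  rintro s₁ ⟨hs₁, h6, h4, hr6⟩
  refine (runs_findGridSize hs₁ h6 h4 hr6).seq ?_
  rintro s₂ ⟨hs₂, h8⟩
  refine (runs_findUnit hs₂).seq ?_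
  rintro s₃ ⟨M, hM, hs₃⟩
  rw [h8] at hs₃
  obtain ⟨T, hT, hconn⟩ := exists_mem_connectedTrials hM (accuracy_pos ε)
  have hμ : 0 ≤ M / gridSize (accuracy ε) := div_nonneg hM.nonneg (Nat.cast_nonneg _)
  refine (runs_search hμ hs₃ hconn).mono (by gcongr) ?_
  rintro s' ⟨t, ht, hout⟩
  exact ⟨M, t, hM, ht, hout⟩

end Scheme

end RealRAM

theorem theorem8 :
    ∃ prog : RealRAM.Prog, ∀ ε : ℝ, 0 < ε → ∃ T : Polynomial ℕ,
      ∀ n : ℕ, 0 < n → ∀ P : Fin n → EuclideanSpace ℝ (Fin 2),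
        ∃ (s : RealRAM.State) (k : ℕ),
          RealRAM.Exec prog (RealRAM.inputState P ε) s k ∧
          k ≤ T.eval n ∧
          IsFeasible P (RealRAM.output n s) ∧
          ∀ r : Fin n → ℝ, IsFeasible P r →
            ∑ i, RealRAM.output n s i ≤ (1 + ε) * ∑ i, r i := by
  refine ⟨RealRAM.scheme, fun ε hε => ⟨RealRAM.schemeTime (RealRAM.accuracy ε), fun n hn P => ?_⟩⟩
  have : NeZero n := ⟨hn.ne'⟩
  obtain ⟨s, k, hexec, hk, M, t, hM, ht, hout⟩ := RealRAM.runs_scheme hε P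
  refine ⟨s, k, hexec, hk, hout ▸ ⟨RealRAM.trialRadii_nonneg ?_ t, ht.1⟩, fun r hr => ?_⟩
  · exact div_nonneg hM.nonneg (Nat.cast_nonneg _)
  have hsum : 0 ≤ ∑ i, r i := Finset.sum_nonneg fun i _ => hr.1 i
  calc ∑ i, RealRAM.output n s i ≤ (1 + 4 / RealRAM.accuracy ε) * ∑ i, r i :=
        hout ▸ RealRAM.sum_trialRadii_le hM (RealRAM.accuracy_pos ε) ht hr
    _ ≤ (1 + ε) * ∑ i, r i := by gcongr; exact RealRAM.four_div_accuracy_le hε
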